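/- Let $d\ge 0$ be an integer and write $D_0$ for the Euclidean metric on $\mathbb R^d$. For a metric $\bar D$ on $\mathbb R^d$, the $\bar D$-length of a path $P:[a,b]\to\mathbb R^d$ is $$\ell_{\bar D}(P)=\sup\sum_{i=1}^{n}\bar D(P(t_i),P(t_{i-1})),$$ where the supremum is over all partitions $a=t_0<\dots<t_n=b$ of $[a,b]$. The metric $\bar D$ is a length metric if for all $x,y\in\mathbb R^d$ the distance $\bar D(x,y)$ is the infimum of the $\bar D$-lengths of the $\bar D$-continuous paths from $x$ to $y$, and it is boundedly compact if every $\bar D$-closed and $\bar D$-bounded set is $\bar D$-compact. For a continuous function $f:\mathbb R^d\to\mathbb R$, let $e^f\cdot D_0$ denote the distance associated with the conformally flat Riemannian metric $e^f(dx_1^2+\dots+dx_d^2)$, that is, $$(e^f\cdot D_0)(x,y)=\inf_\gamma\int_0^1 e^{f(\gamma(t))/2}\,|\gamma'(t)|\,dt,$$ where the infimum is over all $C^1$ paths $\gamma:[0,1]\to\mathbb R^d$ with $\gamma(0)=x$ and $\gamma(1)=y$. Theorem. Let $\bar D$ be a boundedly compact length metric on $\mathbb R^d$ which induces the same topology as the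 Euclidean metric $D_0$. Let $\varepsilon>0$ and $R>0$. Then there exists a bounded continuous function $f:\mathbb R^d\to\mathbb R$ such that $$\sup_{x,y\in[-R,R]^d}\bigl|\bar D(x,y)-(e^f\cdot D_0)(x,y)\bigr|\le\varepsilon .$$ -/

import Mathlib

open Set MeasureTheory
open scoped ENNReal Manifold BoundedContinuousFunction Bundle

/-- The axioms of a metric, for a real-valued function of two points. -/
structure IsMetric {X : Type*} (D : X → X → ℝ) : Prop where
  self : ∀ x, D x x = 0
  eq_of_eq_zero : ∀ x y, D x y = 0 → x = y
  comm : ∀ x y, D x y = D y x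
  triangle : ∀ x y z, D x z ≤ D x y + D y z

namespace IsMetric

variable {X : Type*} {D : X → X → ℝ}

/-- The metric space `(X, D)`; its topology is the one generated by the `D`-balls. -/
abbrev metricSpace (h : IsMetric D) : MetricSpace X where
  dist := D
  dist_self := h.self
  dist_comm := h.comm
  dist_triangle := h.triangle
  eq_of_dist_eq_zero {x y} := h.eq_of_eq_zero x y

/-- The topology on `X` generated by the `D`-balls. -/
abbrev topology (h : IsMetric D) : TopologicalSpace X :=
  h.metricSpace.toUniformSpace.toTopologicalSpace

/-- The metric `D` induces the given topology of `X`. -/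
def InducesTopology [t : TopologicalSpace X] (h : IsMetric D) : Prop :=
  h.topology = t

/-- `(X, D)` is boundedly compact: every `D`-closed and `D`-bounded set is `D`-compact. -/
def BoundedlyCompact (h : IsMetric D) : Prop :=
  @ProperSpace X h.metricSpace.toPseudoMetricSpace

/-- Closed bounded sets are compact if and only if closed balls are. -/
theorem boundedlyCompact_iff (h : IsMetric D) :
    h.BoundedlyCompact ↔
      ∀ s : Set X, @IsClosed X h.topology s → (∃ C : ℝ, ∀ x ∈ s, ∀ y ∈ s, D x y ≤ C) →
        @IsCompact X h.topology s := by
  let := h.metricSpace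
  constructor
  · intro hp s hs hb
    have : ProperSpace X := hp
    exact Metric.isCompact_of_isClosed_isBounded hs (Metric.isBounded_iff.2
      (hb.imp fun C hC x hx y hy => hC x hx y hy))
  · intro H
    refine ⟨fun x r => H _ Metric.isClosed_closedBall ?_⟩
    obtain ⟨C, hC⟩ := Metric.isBounded_iff.1 (Metric.isBounded_closedBall (x := x) (r := r))
    exact ⟨C, fun x hx y hy => hC hx hy⟩

end IsMetric

/-- The length of a path (parametrized by `[0, 1]`) in a metric space: the supremum over all partitions of the sums of the
distances between consecutive points. -/
noncomputable def pathLength {X : Type*} [MetricSpace X] {x y : X} (γ : Path x y) : ℝ≥0∞ :=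
  eVariationOn γ univ

/-- The distance between any two points is the infimum of the lengths of the continuous paths
between them. -/
def IsLengthSpace (X : Type*) [MetricSpace X] : Prop :=
  ∀ x y : X, edist x y = ⨅ γ : Path x y, pathLength γ

/-- `D` is a length metric; both lengths and continuity of paths refer to `D`. -/
def IsMetric.IsLengthMetric {X : Type*} {D : X → X → ℝ} (h : IsMetric D) : Prop :=
  @IsLengthSpace X h.metricSpace

section Conformal

variable {E : Type*} [NormedAddCommGroup E] [InnerProductSpace ℝ E]

/-- The conformally flat Riemannian metric `e^f (dx₁² + ⋯ + dx_d²)`: the inner product on the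
tangent space at `x` is `e^{f x} ⟪v, w⟫`. -/
noncomputable def conformalMetric (f : E →ᵇ ℝ) :
    Bundle.RiemannianMetric (fun x : E => TangentSpace 𝓘(ℝ, E) x) where
  inner x := (Real.exp (f x) • innerSL ℝ (E := E) : E →L[ℝ] E →L[ℝ] ℝ)
  symm x v w := congrArg (Real.exp (f x) * ·) (real_inner_comm (F := E) w v)
  pos x v hv := mul_pos (Real.exp_pos _) (real_inner_self_pos (F := E).2 hv)
  isVonNBounded x := by
    have h : {v : E | Real.exp (f x) * inner ℝ v v < 1} ⊆
        Metric.ball (0 : E) (Real.exp (-f x / 2)) := by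
      intro v hv
      rw [mem_ball_zero_iff]
      refine lt_of_pow_lt_pow_left₀ 2 (Real.exp_pos _).le ?_
      rw [← Real.exp_nat_mul, ← real_inner_self_eq_norm_sq]
      have h2 : Real.exp (f x) * inner ℝ v v < 1 := hv
      rw [show ((2 : ℕ) : ℝ) * (-f x / 2) = -f x by push_cast; ring, Real.exp_neg,
        ← one_div, lt_div_iff₀' (Real.exp_pos _)]
      exact h2
    exact (NormedSpace.isVonNBounded_ball ℝ E _).subset h
  continuousAt x := by
    have h : Continuous fun v : E => Real.exp (f x) * inner ℝ v v := by fun_prop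
    exact h.continuousAt

/-- The distance `e^f · D₀` of the Riemannian metric `e^f (dx₁² + ⋯ + dx_d²)`, i.e. the infimum of
the Riemannian lengths of the `C¹` paths, as an extended nonnegative number. -/
noncomputable def conformalEDist (f : E →ᵇ ℝ) (x y : E) : ℝ≥0∞ :=
  letI : Bundle.RiemannianBundle (fun x : E => TangentSpace 𝓘(ℝ, E) x) :=
    ⟨conformalMetric f⟩
  Manifold.riemannianEDist 𝓘(ℝ, E) x y

/-- The distance `e^f · D₀` as a real number. -/
noncomputable def conformalDist (f : E →ᵇ ℝ) (x y : E) : ℝ :=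
  (conformalEDist f x y).toReal

/-- The length element of `e^f (dx₁² + ⋯ + dx_d²)` is `e^{f/2} |dx|`. -/
theorem conformal_enorm (f : E →ᵇ ℝ) (x : E) (v : TangentSpace 𝓘(ℝ, E) x) :
    letI : Bundle.RiemannianBundle (fun x : E => TangentSpace 𝓘(ℝ, E) x) := ⟨conformalMetric f⟩
    ‖v‖ₑ = ENNReal.ofReal (Real.exp (f x / 2)) * @enorm E _ v := by
  let : Bundle.RiemannianBundle (fun x : E => TangentSpace 𝓘(ℝ, E) x) := ⟨conformalMetric f⟩
  have hE (w : E) : √(Real.exp (f x) * inner ℝ w w) = Real.exp (f x / 2) * ‖w‖ := by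
    rw [real_inner_self_eq_norm_sq, show Real.exp (f x) = Real.exp (f x / 2) ^ 2 by
      rw [← Real.exp_nat_mul]; congr 1; push_cast; ring, ← mul_pow]
    exact Real.sqrt_sq (by positivity)
  have h : ‖v‖ = Real.exp (f x / 2) * @norm E _ v := by
    rw [norm_eq_sqrt_real_inner (F := TangentSpace 𝓘(ℝ, E) x)]
    exact hE v
  rw [← ofReal_norm v, h, ENNReal.ofReal_mul (Real.exp_pos _).le]
  congr 1
  exact ofReal_norm (E := E) v

/-- The Riemannian length of a path is `∫ e^{f(γ(t))/2} |γ'(t)| dt`. -/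
theorem conformal_pathELength (f : E →ᵇ ℝ) (γ : ℝ → E) (a b : ℝ) :
    letI : Bundle.RiemannianBundle (fun x : E => TangentSpace 𝓘(ℝ, E) x) := ⟨conformalMetric f⟩
    Manifold.pathELength 𝓘(ℝ, E) γ a b =
      ∫⁻ t in Icc a b, ENNReal.ofReal (Real.exp (f (γ t) / 2)) * ‖deriv γ t‖ₑ := by
  let : Bundle.RiemannianBundle (fun x : E => TangentSpace 𝓘(ℝ, E) x) := ⟨conformalMetric f⟩
  rw [Manifold.pathELength_eq_lintegral_mfderiv_Icc]
  refine lintegral_congr fun t => ?_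
  refine (conformal_enorm f (γ t) _).trans ?_
  rw [mfderiv_eq_fderiv, ← fderiv_apply_one_eq_deriv]
  rfl

/-- `e^f · D₀ (x, y)` is the infimum of `∫ e^{f(γ(t))/2} |γ'(t)| dt` over the `C¹` paths `γ` from
`x` to `y`. -/
theorem conformalEDist_eq (f : E →ᵇ ℝ) (x y : E) :
    conformalEDist f x y = ⨅ (γ : ℝ → E) (_ : ContDiffOn ℝ 1 γ (Icc 0 1)) (_ : γ 0 = x)
      (_ : γ 1 = y), ∫⁻ t in Icc (0 : ℝ) 1,
        ENNReal.ofReal (Real.exp (f (γ t) / 2)) * ‖deriv γ t‖ₑ := by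
  let : Bundle.RiemannianBundle (fun x : E => TangentSpace 𝓘(ℝ, E) x) := ⟨conformalMetric f⟩
  apply le_antisymm
  · refine le_iInf fun γ => le_iInf fun hγ => le_iInf fun h0 => le_iInf fun h1 => ?_
    rw [← conformal_pathELength]
    exact Manifold.riemannianEDist_le_pathELength (contMDiffOn_iff_contDiffOn.2 hγ) h0 h1
      zero_le_one
  · refine le_of_forall_gt fun r hr => ?_
    obtain ⟨γ, h0, h1, hγ, hlt⟩ := Manifold.exists_lt_of_riemannianEDist_lt hr
    rw [conformal_pathELength] at hlt
    refine lt_of_le_of_lt ?_ hlt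
    exact iInf_le_of_le γ <| iInf_le_of_le (contMDiffOn_iff_contDiffOn.1 hγ) <|
      iInf_le_of_le h0 <| iInf_le _ h1

/-- Any two points are at finite distance, so that `conformalDist` loses nothing. -/
theorem conformalEDist_ne_top (f : E →ᵇ ℝ) (x y : E) : conformalEDist f x y ≠ ∞ := by
  rw [conformalEDist_eq]
  have hγ : ContDiff ℝ 1 (fun t : ℝ => x + t • (y - x)) := by fun_prop
  refine ne_top_of_le_ne_top ?_ (iInf_le_of_le (fun t : ℝ => x + t • (y - x)) <|
    iInf_le_of_le hγ.contDiffOn <| iInf_le_of_le (by simp) <| iInf_le _ (by simp))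
  have hd : ∀ t : ℝ, deriv (fun t : ℝ => x + t • (y - x)) t = y - x := fun t => by
    simpa using (((hasDerivAt_id t).smul_const (y - x)).const_add x).deriv
  refine ne_top_of_le_ne_top (b := ∫⁻ _ in Icc (0 : ℝ) 1,
    ENNReal.ofReal (Real.exp (‖f‖ / 2)) * ‖y - x‖ₑ) ?_ (lintegral_mono fun t => ?_)
  · simp [ENNReal.mul_eq_top]
  · simp only [hd]
    gcongr
    exact (le_abs_self _).trans (f.norm_coe_le_norm _)

end Conformal

/-! The problem is moved to a fine grid `h ℤ^d`. Suppose that a pseudometric `D'` on the grid is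
nowhere much smaller than `D`, while any two grid points of the cube are joined by a grid walk whose
`D'`-length is hardly more than their `D`-distance. A smooth partition of unity spreads the numbers
`D' v w`, for `v`, `w` adjacent, over the edges of the grid and gives a length element. Each edge
then has conformal length at most `D' v w` plus a negligible term, which bounds the conformal
distance from above. The smooth interpolation of `D' p` has gradient bounded by the length element,
so it is `1`-Lipschitz for the conformal distance, which bounds that distance from below
(`exists_conformal_of_grid`).

The restriction of `D` itself will not do: the `D`-lengths of the edges along a grid walk may add up
to far more than the distance of its ends. So all distances are first raised by a constant `E`, and
then finitely many almost geodesic walks are made short by gluing in segments of the line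
(`IsPMetric.exists_glue`). The slack `E` makes gluing possible as long as the new walk avoids,
between its ends, the set `H` of vertices already treated (`Shortcut.exists_add_path`). A walk that
meets an earlier piece travels along the earlier pieces to its last visit of that piece instead
(`exists_shortcut_along`). Hence the errors depend on the number of walks only, and the mesh `h` can
be chosen after that number.

The walks join the close pairs of a finite net, which exists by bounded compactness. Since `D` is a
length metric, distant points are linked by chains in the net (`reach_of_reach_nearby`). Finally
`D'` is pulled back by a retraction of the grid onto `H` with connected fibres
(`exists_grid_retraction`), so that every vertex reaches `H` at no cost. -/

/-! ### Pseudometrics and gluing along a line -/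

/-- The axioms of a pseudometric, for a real-valued function of two points. -/
structure IsPMetric {X : Type*} (D : X → X → ℝ) : Prop where
  self : ∀ x, D x x = 0
  comm : ∀ x y, D x y = D y x
  triangle : ∀ x y z, D x z ≤ D x y + D y z

theorem IsMetric.isPMetric {X : Type*} {D : X → X → ℝ} (h : IsMetric D) : IsPMetric D :=
  ⟨h.self, h.comm, h.triangle⟩

namespace IsPMetric

variable {X : Type*} {D : X → X → ℝ}

theorem nonneg (h : IsPMetric D) (x y : X) : 0 ≤ D x y := by
  have h1 := h.triangle x y x
  rw [h.self, h.comm y x] at h1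
  linarith

theorem comp (h : IsPMetric D) {Y : Type*} (r : Y → X) : IsPMetric fun x y => D (r x) (r y) :=
  ⟨fun _ => h.self _, fun _ _ => h.comm _ _, fun _ _ _ => h.triangle _ _ _⟩

theorem abs_sub_le (h : IsPMetric D) (x y z : X) : |D x y - D x z| ≤ D y z := by
  have h1 := h.triangle x y z
  have h2 := h.triangle x z y
  rw [h.comm z y] at h2
  rw [_root_.abs_sub_le_iff]
  constructor <;> linarith

/-- Gluing a subset of the line to a pseudometric space along a map that does not decrease
distances. -/
theorem exists_glue (h : IsPMetric D) {ι : Type*} [Finite ι] [Nonempty ι] (b : ι → X) (s : ι → ℝ)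
    (hs : ∀ i j, |s i - s j| ≤ D (b i) (b j)) :
    ∃ D' : X → X → ℝ, IsPMetric D' ∧ (∀ x y, D' x y ≤ D x y) ∧
      (∀ i j, D' (b i) (b j) ≤ |s i - s j|) ∧
      ∀ x y, D' x y = D x y ∨ ∃ i j, D' x y = D x (b i) + |s i - s j| + D (b j) y := by
  let F : X → X → ι × ι → ℝ := fun x y p => D x (b p.1) + |s p.1 - s p.2| + D (b p.2) y
  have hF : ∀ x y i j, (⨅ p, F x y p) ≤ D x (b i) + |s i - s j| + D (b j) y := fun x y i j =>
    ciInf_le (Set.finite_range (F x y)).bddBelow (i, j)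
  have hF' : ∀ x y, ∃ i j, (⨅ p, F x y p) = D x (b i) + |s i - s j| + D (b j) y := fun x y => by
    obtain ⟨p, hp⟩ := exists_eq_ciInf_of_finite (f := F x y)
    exact ⟨p.1, p.2, hp.symm⟩
  let D' : X → X → ℝ := fun x y => min (D x y) (⨅ p, F x y p)
  have hle : ∀ x y, D' x y ≤ D x y := fun x y => min_le_left _ _
  have hle' : ∀ x y i j, D' x y ≤ D x (b i) + |s i - s j| + D (b j) y := fun x y i j =>
    (min_le_right _ _).trans (hF x y i j)
  have hor : ∀ x y, D' x y = D x y ∨ ∃ i j, D' x y = D x (b i) + |s i - s j| + D (b j) y := by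
    intro x y
    rcases min_choice (D x y) (⨅ p, F x y p) with h | h
    · exact Or.inl h
    · obtain ⟨i, j, hij⟩ := hF' x y
      exact Or.inr ⟨i, j, h.trans hij⟩
  have hnn : ∀ x y, 0 ≤ D' x y := by
    intro x y
    rcases hor x y with h1 | ⟨i, j, h1⟩
    · rw [h1]; exact h.nonneg _ _
    · rw [h1]
      have := h.nonneg x (b i)
      have := h.nonneg (b j) y
      positivity
  have hcomm : ∀ x y, D' x y ≤ D' y x := by
    intro x y
    rcases hor y x with h1 | ⟨i, j, h1⟩
    · rw [h1, h.comm y x]; exact hle _ _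
    · rw [h1]
      refine (hle' x y j i).trans ?_
      rw [h.comm x, h.comm y, abs_sub_comm]
      linarith
  refine ⟨D', ⟨fun x => ?_, fun x y => le_antisymm (hcomm x y) (hcomm y x), fun x y z => ?_⟩, hle,
    fun i j => ?_, hor⟩
  · exact le_antisymm ((hle x x).trans (h.self x).le) (hnn x x)
  · rcases hor x y with h1 | ⟨i, j, h1⟩ <;> rcases hor y z with h2 | ⟨k, l, h2⟩ <;> rw [h1, h2]
    · exact (hle x z).trans (h.triangle x y z)
    · linarith [hle' x z k l, h.triangle x y (b k)]
    · linarith [hle' x z i j, h.triangle (b j) y z]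
    -- Two excursions along the line merge into one: the detour from `b j` through `y` to `b k`
    -- costs at least `|s j - s k|` by `hs`. This is why one excursion is enough in the definition
    -- of `D'`.
    · linarith [hle' x z i l, hs j k, h.triangle (b j) y (b k), _root_.abs_sub_le (s i) (s j) (s l),
        _root_.abs_sub_le (s j) (s k) (s l)]
  · simpa [h.self] using hle' (b i) (b j) i j

end IsPMetric

/-! ### Walks with costs, and gluing in one walk -/

section Walks

variable {V : Type*}

/-- `y` can be reached from `x` by a walk in `H` of total `d`-cost at most `r`. -/
inductive Reach (adj : V → V → Prop) (d : V → V → ℝ) (H : Set V) : V → V → ℝ → Prop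
  | refl (x : V) (r : ℝ) : x ∈ H → 0 ≤ r → Reach adj d H x x r
  | step (x y z : V) (r r' : ℝ) : x ∈ H → adj x y → Reach adj d H y z r → d x y + r ≤ r' →
      Reach adj d H x z r'

namespace Reach

variable {adj : V → V → Prop} {d : V → V → ℝ} {H : Set V} {x y z : V} {r r' : ℝ}

theorem mono_cost (h : Reach adj d H x y r) (hr : r ≤ r') : Reach adj d H x y r' := by
  cases h with
  | refl _ _ hx h0 => exact .refl _ _ hx (h0.trans hr)
  | step _ w _ q _ hx hadj hw hq => exact .step _ w _ q _ hx hadj hw (hq.trans hr)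

theorem mono (h : Reach adj d H x y r) {d' : V → V → ℝ} {H' : Set V} (hH : H ⊆ H')
    (hd : ∀ x ∈ H, ∀ y ∈ H, d' x y ≤ d x y) : Reach adj d' H' x y r := by
  have key : x ∈ H ∧ Reach adj d' H' x y r := by
    induction h with
    | refl x r hx h0 => exact ⟨hx, .refl _ _ (hH hx) h0⟩
    | step x y z r r' hx hadj _ hq ih =>
      exact ⟨hx, .step _ y _ r _ (hH hx) hadj ih.2 (by linarith [hd x hx y ih.1])⟩
  exact key.2

theorem left_mem (h : Reach adj d H x y r) : x ∈ H := by
  cases h <;> assumption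

theorem trans (h : Reach adj d H x y r) (h' : Reach adj d H y z r') :
    Reach adj d H x z (r + r') := by
  induction h with
  | refl x r hx h0 => exact h'.mono_cost (by linarith)
  | step x w y r q hx hadj _ hq ih =>
    exact .step _ w _ (r + r') _ hx hadj (ih h') (by linarith)

theorem symm (hadj : ∀ x y, adj x y → adj y x) (hd : IsPMetric d) (h : Reach adj d H x y r) :
    Reach adj d H y x r := by
  induction h with
  | refl x r hx h0 => exact .refl _ _ hx h0
  | step x w y r q hx ha hw hq ih =>
    have h1 : Reach adj d H w x (d x w) :=
      .step _ x _ 0 _ hw.left_mem (hadj _ _ ha) (.refl _ _ hx le_rfl) (by rw [hd.comm]; simp)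
    exact (ih.trans h1).mono_cost (by linarith)

theorem dist_le (hd : IsPMetric d) (h : Reach adj d H x y r) : d x y ≤ r := by
  induction h with
  | refl x r hx h0 => rwa [hd.self]
  | step x w y r q hx ha hw hq ih => linarith [hd.triangle x w y]

theorem of_seq {b : ℕ → V} {s : ℕ → ℝ} {k l : ℕ} (hkl : k ≤ l)
    (hb : ∀ i, k ≤ i → i ≤ l → b i ∈ H) (hadj : ∀ i, k ≤ i → i < l → adj (b i) (b (i + 1)))
    (hd : ∀ i, k ≤ i → i < l → d (b i) (b (i + 1)) ≤ s (i + 1) - s i) :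
    Reach adj d H (b k) (b l) (s l - s k) := by
  induction l, hkl using Nat.le_induction with
  | base => exact .refl _ _ (hb k le_rfl le_rfl) (by simp)
  | succ l hkl ih =>
    have h1 := ih (fun i hi hi' => hb i hi (by omega)) (fun i hi hi' => hadj i hi (by omega))
      (fun i hi hi' => hd i hi (by omega))
    have h2 : Reach adj d H (b l) (b (l + 1)) (s (l + 1) - s l) :=
      .step _ (b (l + 1)) _ 0 _ (hb l hkl (by omega)) (hadj l hkl (by omega))
        (.refl _ _ (hb _ (by omega) le_rfl) le_rfl) (by linarith [hd l hkl (by omega)])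
    exact (h1.trans h2).mono_cost (by linarith)

end Reach

/-- `d` is a pseudometric close to `D`, which is longer than `D` by a definite amount except
between points of `H`. -/
structure Shortcut (D d : V → V → ℝ) (H : Set V) (a E : ℝ) : Prop where
  isPMetric : IsPMetric d
  le : ∀ x y, d x y ≤ D x y + E
  lower : ∀ x y, D x y - a ≤ d x y
  far : ∀ x y, x ≠ y → x ∉ H → D x y + E - a ≤ d x y

namespace Shortcut

variable {D d : V → V → ℝ} {H : Set V} {a E e : ℝ}

theorem far_right (h : Shortcut D d H a E) (hD : IsPMetric D) {x y : V} (hxy : x ≠ y)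
    (hy : y ∉ H) : D x y + E - a ≤ d x y := by
  rw [hD.comm, h.isPMetric.comm]
  exact h.far y x hxy.symm hy

/-- The piece of the walk is glued to a segment of the line. This requires that times differ by at
most the `d`-distance. If one of two vertices is interior to the piece, it lies off `H`, and the
slack `E ≥ a + e` of `far` absorbs the errors. Only the pair of the two ends may violate the
condition, so the times are cut off at `d (b k) (b l)`. The cut-off keeps time differences above `D
- 3 * a`, and an excursion along the segment involves two more `d`-distances, each losing at most
`a`; hence `5 * a`. -/
theorem exists_add_path (hD : IsPMetric D) (h : Shortcut D d H a E) (he0 : 0 ≤ e) (he : e ≤ a)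
    (hE : a + e ≤ E) {b : ℕ → V} {s : ℕ → ℝ} {k l : ℕ} (hkl : k ≤ l)
    (hinj : ∀ i, k ≤ i → i < l → ∀ j, i < j → j ≤ l → b i ≠ b j)
    (hs : ∀ i, k ≤ i → ∀ j, i ≤ j → j ≤ l → s i ≤ s j)
    (hlow : ∀ i, k ≤ i → ∀ j, i ≤ j → j ≤ l → D (b i) (b j) - e ≤ s j - s i)
    (hup : ∀ i, k ≤ i → ∀ j, i ≤ j → j ≤ l → s j - s i ≤ D (b i) (b j) + e)
    (hint : ∀ i, k < i → i < l → b i ∉ H) :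
    ∃ d' : V → V → ℝ, (∀ x y, d' x y ≤ d x y) ∧ Shortcut D d' (H ∪ b '' Icc k l) (5 * a) E ∧
      ∀ i, k ≤ i → ∀ j, i ≤ j → j ≤ l → d' (b i) (b j) ≤ s j - s i := by
  have hd := h.isPMetric
  let t : ℕ → ℝ := fun i => min (s i - s k) (d (b k) (b l))
  have ht_mono : ∀ i, k ≤ i → ∀ j, i ≤ j → j ≤ l → t i ≤ t j := fun i hi j hij hj =>
    min_le_min_right _ (by linarith [hs i hi j hij hj])
  have ht_le : ∀ i, k ≤ i → ∀ j, i ≤ j → j ≤ l → t j - t i ≤ s j - s i := by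
    intro i hi j hij hj
    have h1 := hs i hi j hij hj
    simp only [t]
    rcases le_total (s i - s k) (d (b k) (b l)) with h2 | h2
    · rw [min_eq_left h2]; linarith [min_le_left (s j - s k) (d (b k) (b l))]
    · rw [min_eq_right h2]; linarith [min_le_right (s j - s k) (d (b k) (b l))]
  have ht_low : ∀ i, k ≤ i → ∀ j, i ≤ j → j ≤ l → D (b i) (b j) - 3 * a ≤ t j - t i := by
    intro i hi j hij hj
    have h1 := hlow i hi j hij hj
    have h2 := h.lower (b k) (b l)
    have h3 := hup k le_rfl l hkl le_rfl
    have h4 := hs j (hi.trans hij) l hj le_rfl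
    have h5 := min_le_left (s i - s k) (d (b k) (b l))
    -- The cut-off value is at least `D (b k) (b l) - a ≥ s l - s k - e - a`, so it lowers a time by
    -- at most `2 * a`.
    have h6 : s j - s k - 2 * a ≤ t j := le_min (by linarith) (by linarith)
    simp only [t] at h6 ⊢
    linarith
  have hkey : ∀ i, k ≤ i → ∀ j, i ≤ j → j ≤ l → t j - t i ≤ d (b i) (b j) := by
    intro i hi j hij hj
    rcases hij.eq_or_lt with rfl | hlt
    · rw [hd.self]; simp
    have h1 := hup i hi j hij hj
    have h2 := ht_le i hi j hij hj
    have hne := hinj i hi (hlt.trans_le hj) j hlt hj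
    rcases hi.eq_or_lt with rfl | hi'
    · rcases hj.eq_or_lt with rfl | hj'
      · have h3 : t k = 0 := by simp [t, hd.nonneg]
        rw [h3, sub_zero]
        exact min_le_right _ _
      · linarith [h.far_right hD hne (hint j (by omega) hj')]
    · linarith [h.far _ _ hne (hint i hi' (by omega))]
  have habs : ∀ i j : Icc k l, |t i - t j| ≤ d (b i) (b j) := by
    rintro ⟨i, hi, hi'⟩ ⟨j, hj, hj'⟩
    rcases le_total i j with hij | hij
    · rw [abs_sub_comm, abs_of_nonneg (by linarith [ht_mono i hi j hij hj'])]
      exact hkey i hi j hij hj'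
    · rw [abs_of_nonneg (by linarith [ht_mono j hj i hij hi']), hd.comm]
      exact hkey j hj i hij hi'
  have habs' : ∀ i j : Icc k l, D (b i) (b j) - 3 * a ≤ |t i - t j| := by
    rintro ⟨i, hi, hi'⟩ ⟨j, hj, hj'⟩
    rcases le_total i j with hij | hij
    · rw [abs_sub_comm]
      exact (ht_low i hi j hij hj').trans (le_abs_self _)
    · rw [hD.comm]
      exact (ht_low j hj i hij hi').trans (le_abs_self _)
  have : Nonempty (Icc k l) := ⟨⟨k, le_rfl, hkl⟩⟩
  obtain ⟨d', hd', hle, hb, hor⟩ := hd.exists_glue (fun i : Icc k l => b i) (fun i => t i) habs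
  refine ⟨d', hle, ⟨hd', fun x y => (hle x y).trans (h.le x y), fun x y => ?_,
    fun x y hxy hx => ?_⟩, ?_⟩
  · rcases hor x y with h1 | ⟨i, j, h1⟩ <;> rw [h1]
    · linarith [h.lower x y]
    · linarith [h.lower x (b i), h.lower (b j) y, habs' i j, hD.triangle x (b i) y,
        hD.triangle (b i) (b j) y]
  · rw [mem_union, not_or] at hx
    rcases hor x y with h1 | ⟨i, j, h1⟩ <;> rw [h1]
    · linarith [h.far x y hxy hx.1]
    · have hxi : x ≠ b i := fun h => hx.2 ⟨i, i.2, h.symm⟩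
      linarith [h.far x (b i) hxi hx.1, h.lower (b j) y, habs' i j, hD.triangle x (b i) y,
        hD.triangle (b i) (b j) y]
  · intro i hi j hij hj
    refine (hb ⟨i, hi, hij.trans hj⟩ ⟨j, hi.trans hij, hj⟩).trans ?_
    rw [abs_sub_comm, abs_of_nonneg (by linarith [ht_mono i hi j hij hj])]
    exact ht_le i hi j hij hj

end Shortcut

end Walks

/-! ### Rerouting walks along earlier pieces -/

section Rerouting

variable {V : Type*}

/-- A simple walk `b 0, …, b N` with nondecreasing times `s` that differ from the `D`-distances by
at most `e`. -/
structure IsAlmostGeodesic (adj : V → V → Prop) (D : V → V → ℝ) (e : ℝ) (N : ℕ) (b : ℕ → V)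
    (s : ℕ → ℝ) : Prop where
  ne : ∀ i j, i < j → j ≤ N → b i ≠ b j
  mono : ∀ i j, i ≤ j → j ≤ N → s i ≤ s j
  lower : ∀ i j, i ≤ j → j ≤ N → D (b i) (b j) - e ≤ s j - s i
  upper : ∀ i j, i ≤ j → j ≤ N → s j - s i ≤ D (b i) (b j) + e
  adj : ∀ i, i < N → adj (b i) (b (i + 1))

theorem Shortcut.mono {D d : V → V → ℝ} {H : Set V} {a a' E : ℝ} (h : Shortcut D d H a E)
    (ha : a ≤ a') : Shortcut D d H a' E :=
  ⟨h.isPMetric, h.le, fun x y => by linarith [h.lower x y],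
    fun x y hxy hx => by linarith [h.far x y hxy hx]⟩

/-- A family of sets of vertices, each of which can be traversed in its union at a cost close to
the `D`-distance. -/
def IsTraversable (adj : V → V → Prop) (D d : V → V → ℝ) (e : ℝ) (𝒜 : Finset (Set V)) : Prop :=
  ∀ A ∈ 𝒜, ∀ x ∈ A, ∀ y ∈ A, Reach adj d (⋃₀ (𝒜 : Set (Set V))) x y (D x y + e)

-- Induction on the number `j` of sets of `𝒜` that the walk can still meet after the index `k`. The
-- walk is followed and glued in up to its first vertex in an old set `A`; then it is left for a
-- walk through the union to the last visit of `A`, which costs at most `2 * e` more than the time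
-- elapsed. Afterwards `A` is never met again, so each round uses up a set. A round multiplies `a`
-- by `5` and creates one new set, and there are at most `j + 1` rounds, however long the walk is.
open Classical in
theorem exists_shortcut_along {adj : V → V → Prop} (hadj : ∀ x y, adj x y → adj y x)
    {D : V → V → ℝ} (hD : IsPMetric D) {e E : ℝ} (he0 : 0 ≤ e) {N : ℕ} {b : ℕ → V} {s : ℕ → ℝ}
    (hb : IsAlmostGeodesic adj D e N b s) (j : ℕ) :
    ∀ (a : ℝ) (d : V → V → ℝ) (𝒜 : Finset (Set V)) (k : ℕ), k ≤ N → e ≤ a →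
      5 ^ (j + 1) * a ≤ E → Shortcut D d (⋃₀ (𝒜 : Set (Set V))) a E → IsTraversable adj D d e 𝒜 →
      (𝒜.filter fun A => ∃ i, k < i ∧ i ≤ N ∧ b i ∈ A).card ≤ j →
      ∃ (d' : V → V → ℝ) (𝒜' : Finset (Set V)), (∀ x y, d' x y ≤ d x y) ∧ 𝒜 ⊆ 𝒜' ∧
        𝒜'.card ≤ 𝒜.card + (j + 1) ∧
        Shortcut D d' (⋃₀ (𝒜' : Set (Set V))) (5 ^ (j + 1) * a) E ∧
        IsTraversable adj D d' e 𝒜' ∧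
        Reach adj d' (⋃₀ (𝒜' : Set (Set V))) (b k) (b N) (s N - s k + 2 * (j + 1) * e) ∧
        ∀ x ∈ ⋃₀ (𝒜' : Set (Set V)), x ∈ ⋃₀ (𝒜 : Set (Set V)) ∨
          Reach adj d' (⋃₀ (𝒜' : Set (Set V))) (b k) x (s N - s k + 2 * (j + 1) * e) := by
  induction j with
  | zero => ?_
  | succ j ih => ?_
  -- Both cases of the induction begin with one round: `l` is the first index after `k` with `b l`
  -- in an old set, or `N`, and the piece `B` from `k` to `l` is glued in.
  all_goals
    intro a d 𝒜 k hk hea hE hd hgood hcard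
    have ha0 : 0 ≤ a := he0.trans hea
    have hex : ∃ l, k ≤ l ∧ l ≤ N ∧ (∀ i, k < i → i < l → b i ∉ ⋃₀ (𝒜 : Set (Set V))) ∧
        (l = N ∨ k < l ∧ b l ∈ ⋃₀ (𝒜 : Set (Set V))) := by
      by_cases hhit : ∃ l, k < l ∧ l ≤ N ∧ b l ∈ ⋃₀ (𝒜 : Set (Set V))
      · obtain ⟨h1, h2, h3⟩ := Nat.find_spec hhit
        exact ⟨Nat.find hhit, h1.le, h2, fun i hi hi' hmem =>
          Nat.find_min hhit hi' ⟨hi, by omega, hmem⟩, Or.inr ⟨h1, h3⟩⟩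
      · exact ⟨N, hk, le_rfl, fun i hi hi' hmem => hhit ⟨i, hi, hi'.le, hmem⟩, Or.inl rfl⟩
    obtain ⟨l, hkl, hlN, hint, hl⟩ := hex
    have hpow : ∀ n : ℕ, 2 * a ≤ 5 ^ (n + 1) * a := fun n => by
      have h1 : (1 : ℝ) ≤ 5 ^ n := one_le_pow₀ (by norm_num)
      rw [pow_succ]
      nlinarith
    have hE1 : a + e ≤ E := by linarith [(hpow _).trans hE]
    obtain ⟨d₁, hle₁, hd₁, hseq⟩ := hd.exists_add_path hD he0 hea hE1 hkl
      (fun i _ _ m him hml => hb.ne i m him (hml.trans hlN))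
      (fun i _ m him hml => hb.mono i m him (hml.trans hlN))
      (fun i _ m him hml => hb.lower i m him (hml.trans hlN))
      (fun i _ m him hml => hb.upper i m him (hml.trans hlN)) hint
    let B : Set V := b '' Icc k l
    let 𝒜₁ : Finset (Set V) := insert B 𝒜
    have hH₁ : ⋃₀ (𝒜₁ : Set (Set V)) = ⋃₀ (𝒜 : Set (Set V)) ∪ B := by
      simp [𝒜₁, union_comm]
    have hB₁ : B ⊆ ⋃₀ (𝒜₁ : Set (Set V)) := hH₁ ▸ subset_union_right
    rw [← show ⋃₀ (𝒜₁ : Set (Set V)) = ⋃₀ (𝒜 : Set (Set V)) ∪ b '' Icc k l from hH₁] at hd₁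
    have hreach : ∀ i, k ≤ i → ∀ m, i ≤ m → m ≤ l →
        Reach adj d₁ (⋃₀ (𝒜₁ : Set (Set V))) (b i) (b m) (s m - s i) := fun i hi m him hml =>
      .of_seq him (fun n hn hn' => hB₁ ⟨n, ⟨by omega, by omega⟩, rfl⟩)
        (fun n hn hn' => hb.adj n (by omega))
        (fun n hn hn' => hseq n (by omega) (n + 1) (by omega) (by omega))
    have hgood₁ : IsTraversable adj D d₁ e 𝒜₁ := by
      intro A hA x hx y hy
      rcases Finset.mem_insert.1 hA with rfl | hA
      · obtain ⟨i, hi, rfl⟩ := hx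
        obtain ⟨m, hm, rfl⟩ := hy
        rcases le_total i m with him | him
        · exact (hreach i hi.1 m him hm.2).mono_cost (hb.upper i m him (hm.2.trans hlN))
        · rw [hD.comm]
          exact ((hreach m hm.1 i him hi.2).symm hadj hd₁.isPMetric).mono_cost
            (hb.upper m i him (hi.2.trans hlN))
      · exact (hgood A hA x hx y hy).mono (hH₁ ▸ subset_union_left) fun x _ y _ => hle₁ x y
    have hnew : ∀ x ∈ ⋃₀ (𝒜₁ : Set (Set V)), x ∈ ⋃₀ (𝒜 : Set (Set V)) ∨
        Reach adj d₁ (⋃₀ (𝒜₁ : Set (Set V))) (b k) x (s N - s k) := by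
      intro x hx
      rw [hH₁] at hx
      rcases hx with hx | ⟨i, hi, rfl⟩
      · exact Or.inl hx
      · exact Or.inr ((hreach k le_rfl i hi.1 hi.2).mono_cost
          (by linarith [hb.mono i N (hi.2.trans hlN) le_rfl]))
    have hcard₁ : 𝒜₁.card ≤ 𝒜.card + 1 := Finset.card_insert_le _ _
  · -- no set is met after the start, so that the walk is fresh to its end
    have hlN' : l = N := by
      rcases hl with hl | ⟨hkl', A, hA, hAl⟩
      · exact hl
      · have : A ∈ 𝒜.filter fun A => ∃ i, k < i ∧ i ≤ N ∧ b i ∈ A :=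
          Finset.mem_filter.2 ⟨hA, l, hkl', hlN, hAl⟩
        rw [Finset.card_eq_zero.1 (Nat.le_zero.1 hcard)] at this
        simp at this
    subst hlN'
    refine ⟨d₁, 𝒜₁, hle₁, Finset.subset_insert _ _, by simpa using hcard₁, by simpa using hd₁,
      hgood₁, (hreach k le_rfl l hkl le_rfl).mono_cost (by simp; linarith), fun x hx => ?_⟩
    exact (hnew x hx).imp_right fun h => h.mono_cost (by simp; linarith)
  · have h5 : (5 : ℝ) ^ (j + 1) * (5 * a) = 5 ^ (j + 1 + 1) * a := by ring
    have hje : 0 ≤ (j : ℝ) * e := by positivity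
    rcases eq_or_ne l N with rfl | hlN'
    · refine ⟨d₁, 𝒜₁, hle₁, Finset.subset_insert _ _, by omega, hd₁.mono ?_,
        hgood₁, (hreach k le_rfl l hkl le_rfl).mono_cost (by push_cast; linarith), fun x hx => ?_⟩
      · rw [← h5]
        have h1 : (1 : ℝ) ≤ 5 ^ (j + 1) := one_le_pow₀ (by norm_num)
        nlinarith
      · exact (hnew x hx).imp_right fun h => h.mono_cost (by push_cast; linarith)
    obtain ⟨hkl', A, hA, hAl⟩ := hl.resolve_left hlN'
    -- The last visit of `A`.
    obtain ⟨l', ⟨hll', hl'N, hAl'⟩, hmax⟩ : ∃ l', (l ≤ l' ∧ l' ≤ N ∧ b l' ∈ A) ∧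
        ∀ i, l' < i → i ≤ N → b i ∉ A := by
      let P : ℕ → Prop := fun i => l ≤ i ∧ i ≤ N ∧ b i ∈ A
      have hPl : P l := ⟨le_rfl, hlN, hAl⟩
      have hsp : P (Nat.findGreatest P N) := Nat.findGreatest_spec (P := P) hlN hPl
      refine ⟨_, hsp, fun i hi hiN hiA => ?_⟩
      have := Nat.le_findGreatest (P := P) hiN ⟨hsp.1.trans hi.le, hiN, hiA⟩
      omega
    have hskip : Reach adj d₁ (⋃₀ (𝒜₁ : Set (Set V))) (b k) (b l') (s l' - s k + 2 * e) :=
      ((hreach k le_rfl l hkl le_rfl).trans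
        (hgood₁ A (Finset.mem_insert_of_mem hA) _ hAl _ hAl')).mono_cost
        (by linarith [hb.lower l l' hll' hl'N])
    -- The rest of the walk meets neither `A`, by the choice of `l'`, nor the new piece `B`, because
    -- the walk is simple.
    have hcard' : (𝒜₁.filter fun A => ∃ i, l' < i ∧ i ≤ N ∧ b i ∈ A).card ≤ j := by
      have hsub : (𝒜₁.filter fun A => ∃ i, l' < i ∧ i ≤ N ∧ b i ∈ A) ⊆
          (𝒜.filter fun A => ∃ i, k < i ∧ i ≤ N ∧ b i ∈ A).erase A := by
        intro A' hA'
        obtain ⟨hmem, i, hi, hiN, hiA⟩ := Finset.mem_filter.1 hA'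
        rcases Finset.mem_insert.1 hmem with rfl | hmem
        · obtain ⟨m, hm, hmi⟩ := hiA
          exact absurd hmi (hb.ne m i (by have := hm.2; omega) hiN)
        · refine Finset.mem_erase.2 ⟨?_, Finset.mem_filter.2 ⟨hmem, i, by omega, hiN, hiA⟩⟩
          rintro rfl
          exact hmax i hi hiN hiA
      have hAmem : A ∈ 𝒜.filter fun A => ∃ i, k < i ∧ i ≤ N ∧ b i ∈ A :=
        Finset.mem_filter.2 ⟨hA, l, hkl', hlN, hAl⟩
      have := Finset.card_le_card hsub
      rw [Finset.card_erase_of_mem hAmem] at this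
      omega
    obtain ⟨d₂, 𝒜₂, hle₂, hsub₂, hcard₂, hd₂, hgood₂, hr₂, hnew₂⟩ :=
      ih (5 * a) d₁ 𝒜₁ l' hl'N (by linarith) (by linarith) hd₁ hgood₁ hcard'
    have hsub₂' : ⋃₀ (𝒜₁ : Set (Set V)) ⊆ ⋃₀ (𝒜₂ : Set (Set V)) :=
      sUnion_subset_sUnion (by exact_mod_cast hsub₂)
    have hskip₂ := hskip.mono hsub₂' fun x _ y _ => hle₂ x y
    refine ⟨d₂, 𝒜₂, fun x y => (hle₂ x y).trans (hle₁ x y),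
      (Finset.subset_insert _ _).trans hsub₂, by omega, h5 ▸ hd₂, hgood₂,
      (hskip₂.trans hr₂).mono_cost (by push_cast; linarith), fun x hx => ?_⟩
    rcases hnew₂ x hx with hx | hx
    · exact (hnew x hx).imp_right fun h =>
        (h.mono hsub₂' fun x _ y _ => hle₂ x y).mono_cost (by push_cast; linarith)
    · exact Or.inr ((hskip₂.trans hx).mono_cost (by push_cast; linarith))

/-- Finitely many almost geodesics can be made into short walks simultaneously, with an error that
depends on their number only. -/
theorem exists_shortcut_along_family (m n : ℕ) : ∃ C : ℝ, 1 ≤ C ∧ ∃ n' : ℕ,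
    ∀ {V : Type} {adj : V → V → Prop}, (∀ x y, adj x y → adj y x) →
    ∀ {D : V → V → ℝ}, IsPMetric D → ∀ {e E : ℝ}, 0 ≤ e →
    ∀ (N : ℕ → ℕ) (b : ℕ → ℕ → V) (s : ℕ → ℕ → ℝ),
      (∀ i < m, IsAlmostGeodesic adj D e (N i) (b i) (s i)) →
    ∀ (d : V → V → ℝ) (𝒜 : Finset (Set V)), 𝒜.card ≤ n → C * e ≤ E →
      Shortcut D d (⋃₀ (𝒜 : Set (Set V))) e E → IsTraversable adj D d e 𝒜 →
      ∃ (d' : V → V → ℝ) (𝒜' : Finset (Set V)), (∀ x y, d' x y ≤ d x y) ∧ 𝒜 ⊆ 𝒜' ∧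
        𝒜'.card ≤ n' ∧ Shortcut D d' (⋃₀ (𝒜' : Set (Set V))) (C * e) E ∧
        IsTraversable adj D d' e 𝒜' ∧
        (∀ i < m, Reach adj d' (⋃₀ (𝒜' : Set (Set V))) (b i 0) (b i (N i))
          (D (b i 0) (b i (N i)) + C * e)) ∧
        ∀ x ∈ ⋃₀ (𝒜' : Set (Set V)), x ∈ ⋃₀ (𝒜 : Set (Set V)) ∨
          ∃ i < m, Reach adj d' (⋃₀ (𝒜' : Set (Set V))) (b i 0) x
            (D (b i 0) (b i (N i)) + C * e) := by
  classical
  induction m with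
  | zero =>
    refine ⟨1, le_rfl, n, ?_⟩
    intro V adj hadj D hD e E he N b s hb d 𝒜 hcard hE hd hgood
    exact ⟨d, 𝒜, fun _ _ => le_rfl, subset_rfl, hcard, by simpa using hd, hgood, by simp,
      fun x hx => Or.inl hx⟩
  | succ m ih =>
    obtain ⟨C₁, hC₁, n₁, H⟩ := ih
    have h5 : (1 : ℝ) ≤ 5 ^ (n₁ + 1) := one_le_pow₀ (by norm_num)
    have hC0 : 0 ≤ 5 ^ (n₁ + 1) * C₁ + 2 * ((n₁ : ℝ) + 1) := by positivity
    -- The last walk meets at most `n₁` sets and starts with the error `C₁ * e`, so the pseudometric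
    -- loses at most `5 ^ (n₁ + 1) * C₁ * e`. Its cost exceeds the `D`-distance by `2 * (n₁ + 1) *
    -- e` for the jumps and by `e` for its times. At most `n₁ + 1` sets are added. The graph enters
    -- none of these constants.
    refine ⟨5 ^ (n₁ + 1) * C₁ + 2 * (n₁ + 1) + 1, by linarith, n₁ + (n₁ + 1), ?_⟩
    intro V adj hadj D hD e E he N b s hb d 𝒜 hcard hE hd hgood
    have hmul : C₁ * e ≤ 5 ^ (n₁ + 1) * C₁ * e := by
      rw [mul_assoc]
      exact le_mul_of_one_le_left (by positivity) h5
    have hn₁e : 0 ≤ (n₁ : ℝ) * e := by positivity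
    have hC₁e : C₁ * e ≤ E := by nlinarith
    obtain ⟨d₁, 𝒜₁, hle₁, hsub₁, hcard₁, hd₁, hgood₁, hr₁, hnew₁⟩ :=
      H hadj hD he N b s (fun i hi => hb i (by omega)) d 𝒜 hcard hC₁e hd hgood
    have hbm := hb m (by omega)
    obtain ⟨d₂, 𝒜₂, hle₂, hsub₂, hcard₂, hd₂, hgood₂, hr₂, hnew₂⟩ :=
      exists_shortcut_along hadj hD (E := E) he hbm n₁ (C₁ * e) d₁ 𝒜₁ 0 (Nat.zero_le _)
        (le_mul_of_one_le_left he hC₁) (by nlinarith) hd₁ hgood₁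
        ((Finset.card_filter_le _ _).trans hcard₁)
    have hsub₂' : ⋃₀ (𝒜₁ : Set (Set V)) ⊆ ⋃₀ (𝒜₂ : Set (Set V)) :=
      sUnion_subset_sUnion (by exact_mod_cast hsub₂)
    have hup := hbm.upper 0 (N m) (Nat.zero_le _) le_rfl
    have hcost : s m (N m) - s m 0 + 2 * (n₁ + 1) * e ≤ D (b m 0) (b m (N m)) +
        (5 ^ (n₁ + 1) * C₁ + 2 * (n₁ + 1) + 1) * e := by nlinarith
    have hcost' : ∀ t : ℝ, t + C₁ * e ≤ t + (5 ^ (n₁ + 1) * C₁ + 2 * (n₁ + 1) + 1) * e := by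
      intro t; nlinarith
    refine ⟨d₂, 𝒜₂, fun x y => (hle₂ x y).trans (hle₁ x y), hsub₁.trans hsub₂, by omega,
      hd₂.mono (by nlinarith), hgood₂, fun i hi => ?_, fun x hx => ?_⟩
    · rcases Nat.lt_succ_iff_lt_or_eq.1 hi with hi | rfl
      · exact ((hr₁ i hi).mono hsub₂' fun x _ y _ => hle₂ x y).mono_cost (hcost' _)
      · exact hr₂.mono_cost hcost
    · rcases hnew₂ x hx with hx | hx
      · rcases hnew₁ x hx with hx | ⟨i, hi, hx⟩
        · exact Or.inl hx
        · exact Or.inr ⟨i, by omega,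
            (hx.mono hsub₂' fun x _ y _ => hle₂ x y).mono_cost (hcost' _)⟩
      · exact Or.inr ⟨m, by omega, hx.mono_cost hcost⟩

end Rerouting

/-! ### The grid: retraction onto a subset, and timed walks -/

section Grid

variable {d : ℕ}

/-- Neighbours in the grid `ℤ^d`. -/
def gridAdj (v w : Fin d → ℤ) : Prop :=
  ∃ i, w = v + Pi.single i 1 ∨ v = w + Pi.single i 1

theorem gridAdj_symm (v w : Fin d → ℤ) (h : gridAdj v w) : gridAdj w v :=
  h.imp fun _ h => h.symm

/-- The graph distance of the grid. -/
def gridDist (v w : Fin d → ℤ) : ℕ := ∑ i, (v i - w i).natAbs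

theorem gridDist_self (v : Fin d → ℤ) : gridDist v v = 0 := by simp [gridDist]

theorem eq_of_gridDist_eq_zero {v w : Fin d → ℤ} (h : gridDist v w = 0) : v = w := by
  funext i
  have := (Finset.sum_eq_zero_iff.1 h) i (Finset.mem_univ i)
  omega

theorem gridDist_triangle (u v w : Fin d → ℤ) : gridDist u w ≤ gridDist u v + gridDist v w := by
  rw [gridDist, gridDist, gridDist, ← Finset.sum_add_distrib]
  exact Finset.sum_le_sum fun i _ => by omega

theorem gridDist_add_single_self (v : Fin d → ℤ) (i : Fin d) (c : ℤ) :
    gridDist v (v + Pi.single i c) = c.natAbs := by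
  rw [gridDist, Finset.sum_eq_single i]
  · simp
  · intro j _ hj; simp [hj]
  · simp

theorem gridDist_comm (v w : Fin d → ℤ) : gridDist v w = gridDist w v :=
  Finset.sum_congr rfl fun i _ => by omega

theorem gridDist_eq_one_of_adj {v w : Fin d → ℤ} (h : gridAdj v w) : gridDist v w = 1 := by
  obtain ⟨i, rfl | rfl⟩ := h
  · simp [gridDist_add_single_self]
  · rw [gridDist_comm]; simp [gridDist_add_single_self]

theorem exists_gridAdj_closer {v z : Fin d → ℤ} (h : v ≠ z) :
    ∃ w, gridAdj v w ∧ gridDist w z + 1 = gridDist v z := by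
  obtain ⟨i, hi⟩ := Function.ne_iff.1 h
  have key : ∀ c : ℤ, (v i + c - z i).natAbs + 1 = (v i - z i).natAbs →
      gridDist (v + Pi.single i c) z + 1 = gridDist v z := by
    intro c hc
    rw [gridDist, gridDist, ← Finset.add_sum_erase _ _ (Finset.mem_univ i),
      ← Finset.add_sum_erase _ _ (Finset.mem_univ i)]
    have : ∀ j ∈ Finset.univ.erase i,
        ((v + Pi.single i c : Fin d → ℤ) j - z j).natAbs = (v j - z j).natAbs := by
      intro j hj
      simp [Finset.ne_of_mem_erase hj]
    rw [Finset.sum_congr rfl this, Pi.add_apply, Pi.single_eq_same, ← hc]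
    omega
  rcases lt_or_gt_of_ne hi with hlt | hlt
  · exact ⟨_, ⟨i, Or.inl rfl⟩, key 1 (by omega)⟩
  · refine ⟨_, ⟨i, Or.inr ?_⟩, key (-1) (by omega)⟩
    rw [add_assoc, ← Pi.single_add]
    simp

/-- A retraction of the grid onto a nonempty set of vertices whose fibres are connected. -/
theorem exists_grid_retraction {H : Set (Fin d → ℤ)} (hH : H.Nonempty) :
    ∃ r : (Fin d → ℤ) → (Fin d → ℤ), (∀ v, r v ∈ H) ∧ (∀ v ∈ H, r v = v) ∧
      (∀ v, ∀ z ∈ H, gridDist v (r v) ≤ gridDist v z) ∧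
      ∀ D : (Fin d → ℤ) → (Fin d → ℤ) → ℝ, IsPMetric D → ∀ v,
        Reach gridAdj (fun x y => D (r x) (r y)) univ v (r v) 0 := by
  classical
  have hne : ∀ v, ∃ n, ∃ z ∈ H, gridDist v z = n := fun v => ⟨_, hH.some, hH.some_mem, rfl⟩
  let n : (Fin d → ℤ) → ℕ := fun v => Nat.find (hne v)
  have hn : ∀ v, ∃ z ∈ H, gridDist v z = n v := fun v => Nat.find_spec (hne v)
  have hn' : ∀ v, ∀ z ∈ H, n v ≤ gridDist v z := fun v z hz => Nat.find_min' (hne v) ⟨z, hz, rfl⟩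
  have hn0 : ∀ v, n v = 0 → v ∈ H := fun v h => by
    obtain ⟨z, hz, hvz⟩ := hn v
    rwa [eq_of_gridDist_eq_zero (hvz.trans h)]
  have hn1 : ∀ v ∈ H, n v = 0 := fun v hv =>
    Nat.le_zero.1 ((hn' v v hv).trans (gridDist_self v).le)
  have hex : ∀ v, n v ≠ 0 → ∃ w, gridAdj v w ∧ n w + 1 = n v := by
    intro v hv
    obtain ⟨z, hz, hvz⟩ := hn v
    have hvne : v ≠ z := by
      rintro rfl
      exact hv (hn1 _ hz)
    obtain ⟨w, hw, hwz⟩ := exists_gridAdj_closer hvne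
    obtain ⟨z', hz', hwz'⟩ := hn w
    refine ⟨w, hw, ?_⟩
    have h1 := hn' w z hz
    have h2 := hn' v z' hz'
    have h3 := gridDist_triangle v w z'
    rw [gridDist_eq_one_of_adj hw] at h3
    omega
  -- One step towards `H`; `n` is the graph distance to `H`.
  let next : (Fin d → ℤ) → (Fin d → ℤ) := fun v => if h : n v ≠ 0 then (hex v h).choose else v
  have hnext : ∀ v, n v ≠ 0 → gridAdj v (next v) ∧ n (next v) + 1 = n v := fun v h => by
    have : next v = (hex v h).choose := dif_pos h
    rw [this]
    exact (hex v h).choose_spec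
  -- The map `r` is constant along `v, next v, …, r v`, so this walk is free for any pseudometric
  -- pulled back by `r`.
  let r : (Fin d → ℤ) → (Fin d → ℤ) := fun v => next^[n v] v
  have hr0 : ∀ v, n v = 0 → r v = v := fun v h => by simp [r, h]
  have hr : ∀ v, n v ≠ 0 → r (next v) = r v := fun v h => by
    have h1 := (hnext v h).2
    simp only [r]
    rw [← h1, Function.iterate_succ_apply]
  have hrH : ∀ k v, n v = k → r v ∈ H ∧ gridDist v (r v) ≤ k ∧
      ∀ D : (Fin d → ℤ) → (Fin d → ℤ) → ℝ, IsPMetric D →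
        Reach gridAdj (fun x y => D (r x) (r y)) univ v (r v) 0 := by
    intro k
    induction k with
    | zero =>
      intro v hv
      rw [hr0 v hv]
      refine ⟨hn0 v hv, (gridDist_self v).le, fun D hD => .refl _ _ (mem_univ _) le_rfl⟩
    | succ k ih =>
      intro v hv
      have hv0 : n v ≠ 0 := by omega
      obtain ⟨hadj, hnv⟩ := hnext v hv0
      obtain ⟨h1, h2, h3⟩ := ih (next v) (by omega)
      rw [hr v hv0] at h1 h2 h3
      refine ⟨h1, ?_, fun D hD => .step _ (next v) _ 0 _ (mem_univ _) hadj (h3 D hD) ?_⟩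
      · have := gridDist_triangle v (next v) (r v)
        rw [gridDist_eq_one_of_adj hadj] at this
        omega
      · rw [hr v hv0, hD.self, add_zero]
  exact ⟨r, fun v => (hrH _ v rfl).1, fun v hv => hr0 v (hn1 v hv),
    fun v z hz => (hrH _ v rfl).2.1.trans (hn' v z hz), fun D hD v => (hrH _ v rfl).2.2 D hD⟩

/-- Removing the loops of a timed walk. -/
theorem exists_simple_timed_walk {V : Type*} {adj : V → V → Prop} {P : V → ℝ → Prop} {x y : V}
    (h : ∃ (n : ℕ) (b : ℕ → V) (s : ℕ → ℝ), b 0 = x ∧ b n = y ∧ (∀ k ≤ n, P (b k) (s k)) ∧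
      ∀ k < n, (adj (b k) (b (k + 1)) ∨ b k = b (k + 1)) ∧ s k ≤ s (k + 1)) :
    ∃ (n : ℕ) (b : ℕ → V) (s : ℕ → ℝ), b 0 = x ∧ b n = y ∧ (∀ k ≤ n, P (b k) (s k)) ∧
      (∀ k < n, adj (b k) (b (k + 1))) ∧ (∀ i j, i ≤ j → j ≤ n → s i ≤ s j) ∧
      ∀ i j, i < j → j ≤ n → b i ≠ b j := by
  classical
  -- A walk with the fewest steps is simple: if `b i = b j` with `i < j`, cutting out the indices `i
  -- + 1, …, j` gives a shorter one, whose times are still nondecreasing. This also excludes steps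
  -- that stand still.
  obtain ⟨b, s, h0, hn, hP, hstep⟩ := Nat.find_spec h
  set n := Nat.find h with hndef
  have hmono : ∀ i j, i ≤ j → j ≤ n → s i ≤ s j := by
    intro i j hij
    induction j, hij using Nat.le_induction with
    | base => exact fun _ => le_rfl
    | succ j hij ih => exact fun hj => (ih (by omega)).trans (hstep j (by omega)).2
  have hne : ∀ i j, i < j → j ≤ n → b i ≠ b j := by
    intro i j hij hj heq
    have hlt : n - (j - i) < n := by omega
    refine Nat.find_min h hlt ⟨fun k => if k ≤ i then b k else b (k + (j - i)),
      fun k => if k ≤ i then s k else s (k + (j - i)), by simpa using h0, ?_, ?_, ?_⟩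
    · change (if n - (j - i) ≤ i then b (n - (j - i)) else b (n - (j - i) + (j - i))) = y
      split_ifs with hle
      · have hj' : j = n := by omega
        rw [show n - (j - i) = i by omega, heq, hj', hn]
      · rw [show n - (j - i) + (j - i) = n by omega, hn]
    · intro k hk
      dsimp only
      split_ifs with hle
      · exact hP k (by omega)
      · exact hP _ (by omega)
    · intro k hk
      dsimp only
      rcases lt_trichotomy k i with hki | rfl | hki
      · rw [if_pos hki.le, if_pos (by omega), if_pos hki.le, if_pos (by omega)]
        exact hstep k (by omega)
      · rw [if_pos le_rfl, if_neg (by omega), if_pos le_rfl, if_neg (by omega), heq,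
          show k + 1 + (j - k) = j + 1 by omega]
        exact ⟨(hstep j (by omega)).1, hmono k (j + 1) (by omega) (by omega)⟩
      · rw [if_neg (by omega), if_neg (by omega), if_neg (by omega), if_neg (by omega),
          show k + 1 + (j - i) = k + (j - i) + 1 by omega]
        exact hstep _ (by omega)
  refine ⟨n, b, s, h0, hn, hP, fun k hk => ?_, hmono, hne⟩
  exact (hstep k hk).1.resolve_right (hne k (k + 1) (by omega) (by omega))

theorem exists_seq_of_reflTransGen {α : Type*} {R : α → α → Prop} {x y : α}
    (h : Relation.ReflTransGen R x y) :
    ∃ (n : ℕ) (f : ℕ → α), f 0 = x ∧ f n = y ∧ ∀ k < n, R (f k) (f (k + 1)) := by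
  induction h with
  | refl => exact ⟨0, fun _ => x, rfl, rfl, by simp⟩
  | @tail y z _ hyz ih =>
    obtain ⟨n, f, h0, hn, hf⟩ := ih
    refine ⟨n + 1, fun k => if k ≤ n then f k else z, by simpa using h0, by simp, fun k hk => ?_⟩
    rcases Nat.lt_succ_iff_lt_or_eq.1 hk with hk | rfl
    · simp only [hk.le, if_true, Nat.succ_le_of_lt hk]
      exact hf k hk
    · simp [hn, hyz]

/-- A sequence of grid points with nondecreasing times can be refined to a simple timed walk, if
all grid points between consecutive points of the sequence are admissible. -/
theorem exists_simple_timed_grid_walk {P : (Fin d → ℤ) → ℝ → Prop} {M : ℕ}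
    {v : ℕ → Fin d → ℤ} {s : ℕ → ℝ} (hs : ∀ k < M, s k ≤ s (k + 1)) (h0 : ∀ k ≤ M, P (v k) (s k))
    (hP : ∀ k < M, ∀ u, gridDist u (v (k + 1)) ≤ gridDist (v k) (v (k + 1)) → P u (s k)) :
    ∃ (n : ℕ) (b : ℕ → Fin d → ℤ) (t : ℕ → ℝ), b 0 = v 0 ∧ b n = v M ∧
      (∀ k ≤ n, P (b k) (t k)) ∧ (∀ k < n, gridAdj (b k) (b (k + 1))) ∧
      (∀ i j, i ≤ j → j ≤ n → t i ≤ t j) ∧ ∀ i j, i < j → j ≤ n → b i ≠ b j := by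
  refine exists_simple_timed_walk ?_
  -- Space and time move separately: at the constant time `s k` the walk approaches `v (k + 1)`
  -- through ever closer grid points, and then the time alone jumps to `s (k + 1)`.
  let R : (Fin d → ℤ) × ℝ → (Fin d → ℤ) × ℝ → Prop := fun p q =>
    (gridAdj p.1 q.1 ∨ p.1 = q.1) ∧ p.2 ≤ q.2 ∧ P p.1 p.2 ∧ P q.1 q.2
  have hseg : ∀ (w : Fin d → ℤ) (t : ℝ) (L : ℕ), (∀ u, gridDist u w ≤ L → P u t) →
      ∀ n u, gridDist u w = n → n ≤ L → Relation.ReflTransGen R (u, t) (w, t) := by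
    intro w t L hL n
    induction n with
    | zero =>
      intro u hu _
      rw [eq_of_gridDist_eq_zero hu]
    | succ n ih =>
      intro u hu hn
      have hne : u ≠ w := by
        rintro rfl
        rw [gridDist_self] at hu
        omega
      obtain ⟨u', hadj, hu'⟩ := exists_gridAdj_closer hne
      have hR : R (u, t) (u', t) := ⟨Or.inl hadj, le_rfl, hL u (by omega), hL u' (by omega)⟩
      exact .head hR (ih u' (by omega) (by omega))
  have hchain : ∀ k ≤ M, Relation.ReflTransGen R (v 0, s 0) (v k, s k) := by
    intro k
    induction k with
    | zero => exact fun _ => .refl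
    | succ k ih =>
      intro hk
      refine ((ih (by omega)).trans
        (hseg (v (k + 1)) (s k) _ (hP k (by omega)) _ _ rfl le_rfl)).tail ?_
      exact ⟨Or.inr rfl, hs k (by omega), hP k (by omega) _ (by simp [gridDist_self]),
        h0 (k + 1) hk⟩
  obtain ⟨n, f, hf0, hfn, hf⟩ := exists_seq_of_reflTransGen (hchain M le_rfl)
  refine ⟨n, fun k => (f k).1, fun k => (f k).2, by simp [hf0], by simp [hfn], fun k hk => ?_,
    fun k hk => ⟨(hf k hk).1, (hf k hk).2.1⟩⟩
  rcases hk.lt_or_eq with hk | rfl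
  · exact (hf k hk).2.2.1
  · simpa only [hfn] using h0 M le_rfl

end Grid

/-! ### Upper and lower bounds for the conformal distance -/

section ConformalBounds

variable {E : Type*} [NormedAddCommGroup E] [InnerProductSpace ℝ E]

theorem conformalEDist_comm (f : E →ᵇ ℝ) (x y : E) :
    conformalEDist f x y = conformalEDist f y x := by
  let : Bundle.RiemannianBundle (fun x : E => TangentSpace 𝓘(ℝ, E) x) := ⟨conformalMetric f⟩
  exact Manifold.riemannianEDist_comm

theorem conformalEDist_triangle (f : E →ᵇ ℝ) (x y z : E) :
    conformalEDist f x z ≤ conformalEDist f x y + conformalEDist f y z := by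
  let : Bundle.RiemannianBundle (fun x : E => TangentSpace 𝓘(ℝ, E) x) := ⟨conformalMetric f⟩
  exact Manifold.riemannianEDist_triangle

theorem conformalDist_isPMetric (f : E →ᵇ ℝ) : IsPMetric (conformalDist f) where
  self x := by
    have : conformalEDist f x x = 0 := by
      let : Bundle.RiemannianBundle (fun x : E => TangentSpace 𝓘(ℝ, E) x) := ⟨conformalMetric f⟩
      exact Manifold.riemannianEDist_self
    simp [conformalDist, this]
  comm x y := by rw [conformalDist, conformalDist, conformalEDist_comm]
  triangle x y z := by
    rw [conformalDist, conformalDist, conformalDist, ← ENNReal.toReal_add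
      (conformalEDist_ne_top f x y) (conformalEDist_ne_top f y z)]
    exact ENNReal.toReal_mono (ENNReal.add_ne_top.2
      ⟨conformalEDist_ne_top f x y, conformalEDist_ne_top f y z⟩) (conformalEDist_triangle f x y z)

/-- A function whose gradient is bounded by the length element is `1`-Lipschitz. -/
theorem sub_le_conformalDist (f : E →ᵇ ℝ) {U : E → ℝ} (hU : ContDiff ℝ 1 U)
    (hf : ∀ x v, |fderiv ℝ U x v| ≤ Real.exp (f x / 2) * ‖v‖) (x y : E) :
    U y - U x ≤ conformalDist f x y := by
  rw [conformalDist, ← ENNReal.ofReal_le_iff_le_toReal (conformalEDist_ne_top f x y),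
    conformalEDist_eq]
  refine le_iInf fun γ => le_iInf fun hγ => le_iInf fun h0 => le_iInf fun h1 => ?_
  have h := enorm_sub_le_lintegral_deriv_of_contDiffOn_Icc (hU.comp_contDiffOn hγ) zero_le_one
  calc ENNReal.ofReal (U y - U x) ≤ ‖(U ∘ γ) 1 - (U ∘ γ) 0‖ₑ := by
        simp only [Function.comp, h0, h1]
        exact Real.ofReal_le_enorm _
    _ ≤ ∫⁻ t in Icc (0 : ℝ) 1, ‖deriv (U ∘ γ) t‖ₑ := h
    -- The endpoints are dropped because `γ` is differentiable within `[0, 1]` only, whereas `deriv`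
    -- needs a neighbourhood.
    _ = ∫⁻ t in Ioo (0 : ℝ) 1, ‖deriv (U ∘ γ) t‖ₑ := by rw [restrict_Ioo_eq_restrict_Icc]
    _ ≤ ∫⁻ t in Ioo (0 : ℝ) 1, ENNReal.ofReal (Real.exp (f (γ t) / 2)) * ‖deriv γ t‖ₑ := by
        refine setLIntegral_mono' measurableSet_Ioo fun t ht => ?_
        have hd : DifferentiableAt ℝ γ t :=
          (hγ.differentiableOn one_ne_zero t (Ioo_subset_Icc_self ht)).differentiableAt
            (Icc_mem_nhds ht.1 ht.2)
        have h2 : deriv (U ∘ γ) t = fderiv ℝ U (γ t) (deriv γ t) :=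
          fderiv_comp_deriv t (hU.differentiable one_ne_zero _) hd
        rw [h2, ← ofReal_norm (deriv γ t), ← ENNReal.ofReal_mul (Real.exp_pos _).le,
          ← ofReal_norm (fderiv ℝ U (γ t) (deriv γ t))]
        exact ENNReal.ofReal_le_ofReal (hf _ _)
    _ = _ := by rw [restrict_Ioo_eq_restrict_Icc]

theorem conformalDist_le_integral (f : E →ᵇ ℝ) (x v : E) {g : ℝ → ℝ} (hg : Continuous g)
    (hf : ∀ t ∈ Icc (0 : ℝ) 1, Real.exp (f (x + t • v) / 2) * ‖v‖ ≤ g t) :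
    conformalDist f x (x + v) ≤ ∫ t in (0 : ℝ)..1, g t := by
  have hγ : ContDiff ℝ 1 (fun t : ℝ => x + t • v) := by fun_prop
  have hd : ∀ t : ℝ, deriv (fun t : ℝ => x + t • v) t = v := fun t => by
    simpa using (((hasDerivAt_id t).smul_const v).const_add x).deriv
  have hg0 : ∀ t ∈ Icc (0 : ℝ) 1, 0 ≤ g t := fun t ht => le_trans (by positivity) (hf t ht)
  have hle : conformalEDist f x (x + v) ≤ ∫⁻ t in Icc (0 : ℝ) 1, ENNReal.ofReal (g t) := by
    rw [conformalEDist_eq]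
    refine le_trans (iInf_le_of_le (fun t : ℝ => x + t • v) <| iInf_le_of_le hγ.contDiffOn <|
      iInf_le_of_le (by simp) <| iInf_le _ (by simp)) ?_
    refine setLIntegral_mono' measurableSet_Icc fun t ht => ?_
    rw [hd, ← ofReal_norm v, ← ENNReal.ofReal_mul (Real.exp_pos _).le]
    exact ENNReal.ofReal_le_ofReal (hf t ht)
  rw [conformalDist]
  refine ENNReal.toReal_le_of_le_ofReal
    (intervalIntegral.integral_nonneg zero_le_one hg0) (hle.trans ?_)
  rw [intervalIntegral.integral_of_le zero_le_one, ← integral_Icc_eq_integral_Ioc,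
    ofReal_integral_eq_lintegral_ofReal]
  · exact hg.continuousOn.integrableOn_Icc
  · exact (ae_restrict_iff' measurableSet_Icc).2 (Filter.Eventually.of_forall hg0)

theorem conformalDist_le_of_bound (f : E →ᵇ ℝ) (x v : E) {B : ℝ}
    (hf : ∀ t ∈ Icc (0 : ℝ) 1, Real.exp (f (x + t • v) / 2) ≤ B) :
    conformalDist f x (x + v) ≤ B * ‖v‖ := by
  have h := conformalDist_le_integral f x v (g := fun _ => B * ‖v‖) continuous_const
    fun t ht => by gcongr; exact hf t ht
  simpa using h

end ConformalBounds

/-! ### A smooth partition of unity of the line -/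

section SmoothPartition

open Real (smoothTransition)

theorem differentiable_smoothTransition : Differentiable ℝ smoothTransition :=
  (Real.smoothTransition.contDiff (n := 1)).differentiable one_ne_zero

theorem continuous_deriv_smoothTransition : Continuous (deriv smoothTransition) :=
  (Real.smoothTransition.contDiff (n := 1)).continuous_deriv le_rfl

theorem deriv_smoothTransition_nonneg (t : ℝ) : 0 ≤ deriv smoothTransition t :=
  Real.smoothTransition.monotone.deriv_nonneg

theorem deriv_smoothTransition_of_nonpos {t : ℝ} (ht : t ≤ 0) : deriv smoothTransition t = 0 :=
  IsLocalMin.deriv_eq_zero <| Filter.Eventually.of_forall fun s => by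
    rw [Real.smoothTransition.zero_of_nonpos ht]
    exact Real.smoothTransition.nonneg s

theorem deriv_smoothTransition_of_one_le {t : ℝ} (ht : 1 ≤ t) : deriv smoothTransition t = 0 :=
  IsLocalMax.deriv_eq_zero <| Filter.Eventually.of_forall fun s => by
    rw [Real.smoothTransition.one_of_one_le ht]
    exact Real.smoothTransition.le_one s

theorem exists_deriv_smoothTransition_le : ∃ B : ℝ, 0 ≤ B ∧ ∀ t, deriv smoothTransition t ≤ B := by
  obtain ⟨B, hB⟩ := isCompact_Icc.exists_bound_of_continuousOn (s := Icc (0 : ℝ) 1)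
    continuous_deriv_smoothTransition.continuousOn
  have hB0 : 0 ≤ B := (norm_nonneg _).trans (hB 0 (by simp))
  refine ⟨B, hB0, fun t => ?_⟩
  rcases le_or_gt t 0 with h | h
  · rwa [deriv_smoothTransition_of_nonpos h]
  rcases le_or_gt 1 t with h' | h'
  · rwa [deriv_smoothTransition_of_one_le h']
  · exact (le_abs_self _).trans (hB t ⟨h.le, h'.le⟩)

variable {K : ℕ}

/-- The integers from `-K` to `K`. -/
def boxInt (g : Fin (2 * K + 1)) : ℤ := (g : ℕ) - (K : ℤ)

theorem boxInt_injective : Function.Injective (boxInt (K := K)) := fun g g' h =>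
  Fin.ext (by simp only [boxInt] at h; omega)

theorem boxInt_add_one {g : Fin (2 * K + 1)} (h : g + 1 ≠ 0) : boxInt (g + 1) = boxInt g + 1 := by
  have h1 : ((g + 1 : Fin (2 * K + 1)) : ℕ) = g + 1 := by
    rw [Fin.val_add_one]
    refine if_neg ?_
    rintro rfl
    exact h (Fin.last_add_one _)
  simp only [boxInt, h1]
  push_cast
  ring

theorem exists_boxInt {n : ℤ} (h : |n| ≤ K) : ∃ g : Fin (2 * K + 1), boxInt g = n := by
  rw [abs_le] at h
  refine ⟨⟨(n + K).toNat, by omega⟩, ?_⟩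
  simp only [boxInt]
  omega

theorem boxInt_le (g : Fin (2 * K + 1)) : boxInt g ≤ K := by
  have := g.2
  simp only [boxInt]
  omega

theorem neg_le_boxInt (g : Fin (2 * K + 1)) : -(K : ℤ) ≤ boxInt g := by
  simp only [boxInt]
  omega

theorem boxInt_eq_neg_iff {g : Fin (2 * K + 1)} : boxInt g = -K ↔ g = 0 := by
  rw [Fin.ext_iff]
  simp only [boxInt, Fin.val_zero]
  omega

theorem boxInt_of_add_one_eq_zero {g : Fin (2 * K + 1)} (h : g + 1 = 0) : boxInt g = K := by
  have h1 : ((g + 1 : Fin (2 * K + 1)) : ℕ) = 0 := by rw [h]; rfl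
  rw [Fin.val_add_one] at h1
  split_ifs at h1 with h2
  rw [h2]
  simp only [boxInt, Fin.val_last]
  push_cast
  ring

/-- Smooth steps from `0` to `1`, the one with index `g` on the interval `[g - 1, g]`. -/
noncomputable def stepFun (g : Fin (2 * K + 1)) (t : ℝ) : ℝ :=
  if g = 0 then 0 else smoothTransition (t - boxInt g + 1)

/-- The derivatives of the smooth steps. -/
noncomputable def stepDeriv (g : Fin (2 * K + 1)) (t : ℝ) : ℝ :=
  if g = 0 then 0 else deriv smoothTransition (t - boxInt g + 1)

/-- A smooth partition of unity of the line, indexed by the integers from `-K` to `K`. -/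
noncomputable def bumpFun (g : Fin (2 * K + 1)) (t : ℝ) : ℝ :=
  (if g = 0 then 1 else 0) + stepFun g t - stepFun (g + 1) t

theorem contDiff_bumpFun (g : Fin (2 * K + 1)) : ContDiff ℝ 1 (bumpFun g) := by
  have h : ∀ g : Fin (2 * K + 1), ContDiff ℝ 1 (stepFun g) := by
    intro g
    unfold stepFun
    split_ifs
    · exact contDiff_const
    · exact Real.smoothTransition.contDiff.comp (by fun_prop)
  exact (contDiff_const.add (h g)).sub (h (g + 1))

theorem hasDerivAt_bumpFun (g : Fin (2 * K + 1)) (t : ℝ) :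
    HasDerivAt (bumpFun g) (stepDeriv g t - stepDeriv (g + 1) t) t := by
  have h : ∀ g : Fin (2 * K + 1), HasDerivAt (stepFun g) (stepDeriv g t) t := by
    intro g
    unfold stepFun stepDeriv
    split_ifs
    · exact hasDerivAt_const t 0
    · have h1 : HasDerivAt (fun t : ℝ => t - boxInt g + 1) 1 t :=
        ((hasDerivAt_id t).sub_const _).add_const _
      have h2 := (differentiable_smoothTransition (t - boxInt g + 1)).hasDerivAt.comp t h1
      rwa [mul_one] at h2
  exact ((h g).const_add _).sub (h (g + 1))

theorem continuous_stepDeriv (g : Fin (2 * K + 1)) : Continuous (stepDeriv g) := by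
  unfold stepDeriv
  split_ifs
  · exact continuous_const
  · exact continuous_deriv_smoothTransition.comp (by fun_prop)

theorem stepDeriv_nonneg (g : Fin (2 * K + 1)) (t : ℝ) : 0 ≤ stepDeriv g t := by
  unfold stepDeriv
  split_ifs
  · exact le_rfl
  · exact deriv_smoothTransition_nonneg _

theorem stepDeriv_le {B : ℝ} (hB0 : 0 ≤ B) (hB : ∀ t, deriv smoothTransition t ≤ B)
    (g : Fin (2 * K + 1)) (t : ℝ) : stepDeriv g t ≤ B := by
  unfold stepDeriv
  split_ifs
  · exact hB0
  · exact hB _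

theorem stepDeriv_of_le {g : Fin (2 * K + 1)} {t : ℝ} (h : t ≤ boxInt g - 1) :
    stepDeriv g t = 0 := by
  unfold stepDeriv
  split_ifs
  · rfl
  · exact deriv_smoothTransition_of_nonpos (by linarith)

theorem stepDeriv_of_ge {g : Fin (2 * K + 1)} {t : ℝ} (h : boxInt g ≤ t) :
    stepDeriv g t = 0 := by
  unfold stepDeriv
  split_ifs
  · rfl
  · exact deriv_smoothTransition_of_one_le (by linarith)

/-- At most one term is nonzero, the one with index `⌈t⌉`, as the steps rise on non-overlapping
intervals. So the bound does not depend on `K`. -/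
theorem sum_stepDeriv_le {B : ℝ} (hB0 : 0 ≤ B) (hB : ∀ t, deriv smoothTransition t ≤ B) (t : ℝ) :
    ∑ g : Fin (2 * K + 1), stepDeriv g t ≤ B := by
  have h1 : ∀ g : Fin (2 * K + 1), boxInt g ≠ ⌈t⌉ → stepDeriv g t = 0 := by
    intro g hg
    by_contra hne
    refine hg (Int.ceil_eq_iff.2 ⟨?_, ?_⟩).symm
    · by_contra hlt
      exact hne (stepDeriv_of_le (not_lt.1 hlt))
    · by_contra hlt
      exact hne (stepDeriv_of_ge (not_le.1 hlt).le)
  by_cases hex : ∃ g : Fin (2 * K + 1), boxInt g = ⌈t⌉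
  · obtain ⟨g, hg⟩ := hex
    rw [Finset.sum_eq_single g (fun g' _ hne => h1 g' fun h => hne (boxInt_injective (h.trans
      hg.symm))) (by simp)]
    exact stepDeriv_le hB0 hB g t
  · rw [Finset.sum_eq_zero fun g _ => h1 g fun h => hex ⟨g, h⟩]
    exact hB0

theorem bumpFun_nonneg (g : Fin (2 * K + 1)) (t : ℝ) : 0 ≤ bumpFun g t := by
  unfold bumpFun stepFun
  by_cases h0 : g = 0
  · rw [if_pos h0, if_pos h0]
    split_ifs
    · norm_num
    · linarith [Real.smoothTransition.le_one (t - boxInt (g + 1) + 1)]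
  · rw [if_neg h0, if_neg h0]
    split_ifs with h1
    · linarith [Real.smoothTransition.nonneg (t - boxInt g + 1)]
    · have : smoothTransition (t - boxInt (g + 1) + 1) ≤ smoothTransition (t - boxInt g + 1) := by
        apply Real.smoothTransition.monotone
        rw [boxInt_add_one h1]
        push_cast
        linarith
      linarith

/-- The sum telescopes cyclically, since `g + 1` wraps around in `Fin (2 * K + 1)`. The convention
`stepFun 0 = 0` makes the wrapped term vanish, and the extra `1` at `g = 0` remains. -/
theorem sum_bumpFun (t : ℝ) : ∑ g : Fin (2 * K + 1), bumpFun g t = 1 := by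
  have h : ∑ g : Fin (2 * K + 1), stepFun (g + 1) t = ∑ g : Fin (2 * K + 1), stepFun g t :=
    Equiv.sum_comp (Equiv.addRight (1 : Fin (2 * K + 1))) fun g => stepFun g t
  simp only [bumpFun, Finset.sum_sub_distrib, Finset.sum_add_distrib, h]
  simp

theorem bumpFun_le_one (g : Fin (2 * K + 1)) (t : ℝ) : bumpFun g t ≤ 1 := by
  rw [← sum_bumpFun (K := K) t]
  exact Finset.single_le_sum (fun g _ => bumpFun_nonneg g t) (Finset.mem_univ g)

/-- The bound on `t` is there because the two extreme bumps do not decay outside `[-K, K]`: they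
stay equal to `1` beyond their own end. -/
theorem bumpFun_eq_zero {g : Fin (2 * K + 1)} {t : ℝ} (ht : |t| ≤ K) (h : 1 ≤ |t - boxInt g|) :
    bumpFun g t = 0 := by
  rw [abs_le] at ht
  unfold bumpFun stepFun
  rcases le_abs.1 h with h | h
  · have h1 : g + 1 ≠ 0 := fun h1 => by
      rw [boxInt_of_add_one_eq_zero h1] at h
      push_cast at h
      linarith
    rw [if_neg h1, boxInt_add_one h1, Real.smoothTransition.one_of_one_le
      (x := t - ((boxInt g + 1 : ℤ) : ℝ) + 1) (by push_cast; linarith)]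
    split_ifs
    · norm_num
    · rw [Real.smoothTransition.one_of_one_le (by linarith)]
      norm_num
  · have h0 : g ≠ 0 := fun h0 => by
      rw [boxInt_eq_neg_iff.2 h0] at h
      push_cast at h
      linarith
    rw [if_neg h0, if_neg h0, Real.smoothTransition.zero_of_nonpos (x := t - boxInt g + 1)
      (by linarith)]
    split_ifs with h1
    · norm_num
    · rw [boxInt_add_one h1, Real.smoothTransition.zero_of_nonpos (by push_cast; linarith)]
      norm_num

theorem bumpFun_boxInt (g g' : Fin (2 * K + 1)) :
    bumpFun g (boxInt g' : ℝ) = if g = g' then 1 else 0 := by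
  have hle : |((boxInt g' : ℤ) : ℝ)| ≤ K := by
    rw [abs_le]
    exact ⟨by exact_mod_cast neg_le_boxInt g', by exact_mod_cast boxInt_le g'⟩
  have hne : ∀ g : Fin (2 * K + 1), g ≠ g' → bumpFun g (boxInt g' : ℝ) = 0 := fun g hg => by
    refine bumpFun_eq_zero hle ?_
    have h1 : boxInt g' - boxInt g ≠ 0 := sub_ne_zero.2 fun h => hg (boxInt_injective h).symm
    exact_mod_cast Int.one_le_abs h1
  split_ifs with h
  · subst h
    rw [← sum_bumpFun (K := K) (boxInt g : ℝ)]
    exact (Finset.sum_eq_single g (fun g' _ h => hne g' h) (by simp)).symm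
  · exact hne g h

theorem stepDeriv_boxInt (g g' : Fin (2 * K + 1)) : stepDeriv g (boxInt g' : ℝ) = 0 := by
  rcases le_or_gt (boxInt g) (boxInt g') with h | h
  · exact stepDeriv_of_ge (by exact_mod_cast h)
  · refine stepDeriv_of_le ?_
    have : boxInt g' ≤ boxInt g - 1 := by omega
    exact_mod_cast this

end SmoothPartition

/-! ### Interpolation on the grid and the conformal length element -/

section Interpolation

variable {d K : ℕ}

/-- The grid point `h v` of `ℝ^d`. -/
noncomputable def gridPt (h : ℝ) (v : Fin d → ℤ) : EuclideanSpace ℝ (Fin d) :=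
  WithLp.toLp 2 fun i => h * v i

@[simp] theorem gridPt_apply (h : ℝ) (v : Fin d → ℤ) (i : Fin d) : gridPt h v i = h * v i := rfl

/-- The grid points with coordinates between `-K` and `K`. -/
def boxVec (g : Fin d → Fin (2 * K + 1)) : Fin d → ℤ := fun i => boxInt (g i)

/-- The smooth interpolation of a function on the grid points of a box. -/
noncomputable def interp (h : ℝ) (u : (Fin d → Fin (2 * K + 1)) → ℝ)
    (x : EuclideanSpace ℝ (Fin d)) : ℝ :=
  ∑ g, u g * ∏ i, bumpFun (g i) (x i / h)

/-- The weight of the edge in direction `i` that ends in the grid point `g`. -/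
noncomputable def edgeWeight (h : ℝ) (i : Fin d) (g : Fin d → Fin (2 * K + 1))
    (x : EuclideanSpace ℝ (Fin d)) : ℝ :=
  stepDeriv (g i) (x i / h) / h * ∏ j ∈ Finset.univ.erase i, bumpFun (g j) (x j / h)

theorem edgeWeight_nonneg {h : ℝ} (hh : 0 < h) (i : Fin d) (g : Fin d → Fin (2 * K + 1))
    (x : EuclideanSpace ℝ (Fin d)) : 0 ≤ edgeWeight h i g x :=
  mul_nonneg (div_nonneg (stepDeriv_nonneg _ _) hh.le)
    (Finset.prod_nonneg fun _ _ => bumpFun_nonneg _ _)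

theorem continuous_edgeWeight (h : ℝ) (i : Fin d) (g : Fin d → Fin (2 * K + 1)) :
    Continuous (edgeWeight h i g) := by
  unfold edgeWeight
  have h1 := continuous_stepDeriv (g i)
  have h2 : ∀ j, Continuous (bumpFun (g j)) := fun j => (contDiff_bumpFun (g j)).continuous
  fun_prop

theorem contDiff_interp (h : ℝ) (u : (Fin d → Fin (2 * K + 1)) → ℝ) :
    ContDiff ℝ 1 (interp h u) := by
  unfold interp
  refine ContDiff.sum fun g _ => contDiff_const.mul (contDiff_prod fun i _ => ?_)
  exact (contDiff_bumpFun (g i)).comp (by fun_prop)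

/-- Summation by parts turns derivatives of bumps into differences of `u` across edges. The cyclic
shift has no boundary terms: where `g i = 0`, the predecessor of `g` wraps around, but `stepDeriv 0
= 0` makes the weight vanish. -/
theorem sum_by_parts_edgeWeight (h : ℝ) (u : (Fin d → Fin (2 * K + 1)) → ℝ) (i : Fin d)
    (x : EuclideanSpace ℝ (Fin d)) :
    ∑ g, u g * ((stepDeriv (g i) (x i / h) - stepDeriv (g i + 1) (x i / h)) / h *
        ∏ j ∈ Finset.univ.erase i, bumpFun (g j) (x j / h)) =
      ∑ g, (u g - u (g - Pi.single i 1)) * edgeWeight h i g x := by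
  have h1 : ∑ g : Fin d → Fin (2 * K + 1), u g * edgeWeight h i (g + Pi.single i 1) x =
      ∑ g, u (g - Pi.single i 1) * edgeWeight h i g x := by
    refine Eq.trans ?_ (Equiv.sum_comp (Equiv.addRight (Pi.single i (1 : Fin (2 * K + 1))))
      fun g : Fin d → Fin (2 * K + 1) => u (g - Pi.single i 1) * edgeWeight h i g x)
    simp
  have h2 : ∀ g : Fin d → Fin (2 * K + 1), edgeWeight h i (g + Pi.single i 1) x =
      stepDeriv (g i + 1) (x i / h) / h *
        ∏ j ∈ Finset.univ.erase i, bumpFun (g j) (x j / h) := by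
    intro g
    unfold edgeWeight
    congr 1
    · simp
    · refine Finset.prod_congr rfl fun j hj => ?_
      simp [Finset.ne_of_mem_erase hj]
  simp only [sub_mul, Finset.sum_sub_distrib]
  rw [← h1, ← Finset.sum_sub_distrib]
  refine Finset.sum_congr rfl fun g _ => ?_
  rw [h2, edgeWeight]
  ring

theorem fderiv_interp (h : ℝ) (u : (Fin d → Fin (2 * K + 1)) → ℝ)
    (x v : EuclideanSpace ℝ (Fin d)) :
    fderiv ℝ (interp h u) x v =
      ∑ i, v i * ∑ g, (u g - u (g - Pi.single i 1)) * edgeWeight h i g x := by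
  have hline : HasDerivAt (fun t : ℝ => x + t • v) v 0 := by
    simpa using ((hasDerivAt_id (0 : ℝ)).smul_const v).const_add x
  have h1 : HasDerivAt (fun t : ℝ => interp h u (x + t • v)) (fderiv ℝ (interp h u) x v) 0 := by
    have h2 : HasFDerivAt (interp h u) (fderiv ℝ (interp h u) x) (x + (0 : ℝ) • v) := by
      rw [zero_smul, add_zero]
      exact ((contDiff_interp h u).differentiable one_ne_zero x).hasFDerivAt
    exact h2.comp_hasDerivAt 0 hline
  have h3 : ∀ (g : Fin d → Fin (2 * K + 1)) (i : Fin d),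
      HasDerivAt (fun t : ℝ => bumpFun (g i) ((x + t • v) i / h))
        ((stepDeriv (g i) (x i / h) - stepDeriv (g i + 1) (x i / h)) * (v i / h)) 0 := by
    intro g i
    have h4 : HasDerivAt (fun t : ℝ => (x + t • v) i / h) (v i / h) 0 := by
      have : HasDerivAt (fun t : ℝ => (x i + t * v i) / h) (1 * v i / h) 0 :=
        (((hasDerivAt_id (0 : ℝ)).mul_const (v i)).const_add (x i)).div_const h
      simpa using this
    have h5 := hasDerivAt_bumpFun (g i) (x i / h)
    have h6 : x i / h = (x + (0 : ℝ) • v) i / h := by simp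
    rw [h6] at h5
    have h7 := h5.comp (0 : ℝ) h4
    rwa [← h6] at h7
  have h6 : HasDerivAt (fun t : ℝ => interp h u (x + t • v))
      (∑ g, u g * ∑ i, (∏ j ∈ Finset.univ.erase i, bumpFun (g j) ((x + (0 : ℝ) • v) j / h)) •
        ((stepDeriv (g i) (x i / h) - stepDeriv (g i + 1) (x i / h)) * (v i / h))) 0 := by
    unfold interp
    exact HasDerivAt.fun_sum fun g _ => (HasDerivAt.fun_finsetProd fun i _ => h3 g i).const_mul _
  rw [h1.unique h6]
  simp only [zero_smul, add_zero, ← sum_by_parts_edgeWeight, Finset.mul_sum, smul_eq_mul]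
  rw [Finset.sum_comm]
  refine Finset.sum_congr rfl fun i _ => Finset.sum_congr rfl fun g _ => ?_
  ring

/-- The length element of the conformal metric attached to a pseudometric on the grid. -/
noncomputable def gridDensity (h κ : ℝ) (K : ℕ) (D : (Fin d → ℤ) → (Fin d → ℤ) → ℝ)
    (x : EuclideanSpace ℝ (Fin d)) : ℝ :=
  κ + ∑ i, ∑ g : Fin d → Fin (2 * K + 1),
    D (boxVec (g - Pi.single i 1)) (boxVec g) * edgeWeight h i g x

variable {h κ : ℝ} {D : (Fin d → ℤ) → (Fin d → ℤ) → ℝ}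

theorem le_gridDensity (hh : 0 < h) (hD : IsPMetric D) (x : EuclideanSpace ℝ (Fin d)) :
    κ ≤ gridDensity h κ K D x :=
  le_add_of_nonneg_right <| Finset.sum_nonneg fun i _ => Finset.sum_nonneg fun g _ =>
    mul_nonneg (hD.nonneg _ _) (edgeWeight_nonneg hh i g x)

theorem continuous_gridDensity : Continuous (gridDensity h κ K D) := by
  have := fun i g => continuous_edgeWeight (d := d) (K := K) h i g
  unfold gridDensity
  fun_prop

theorem edgeWeight_le (hh : 0 < h) {B : ℝ} (hB0 : 0 ≤ B)
    (hB : ∀ t, deriv Real.smoothTransition t ≤ B) (i : Fin d) (g : Fin d → Fin (2 * K + 1))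
    (x : EuclideanSpace ℝ (Fin d)) : edgeWeight h i g x ≤ B / h := by
  have h1 : ∏ j ∈ Finset.univ.erase i, bumpFun (g j) (x j / h) ≤ 1 :=
    Finset.prod_le_one (fun _ _ => bumpFun_nonneg _ _) fun _ _ => bumpFun_le_one _ _
  have h2 : stepDeriv (g i) (x i / h) / h ≤ B / h := by
    gcongr
    exact stepDeriv_le hB0 hB _ _
  have h3 : 0 ≤ stepDeriv (g i) (x i / h) / h := div_nonneg (stepDeriv_nonneg _ _) hh.le
  exact (mul_le_of_le_one_right h3 h1).trans h2

/-- The conformal factor with the given length element. -/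
theorem exists_conformal_factor (hh : 0 < h) (hκ : 0 < κ) (hD : IsPMetric D) :
    ∃ f : EuclideanSpace ℝ (Fin d) →ᵇ ℝ, ∀ x, Real.exp (f x / 2) = gridDensity h κ K D x := by
  obtain ⟨B, hB0, hB⟩ := exists_deriv_smoothTransition_le
  have hpos : ∀ x, 0 < gridDensity h κ K D x := fun x => hκ.trans_le (le_gridDensity hh hD x)
  let M : ℝ := κ + ∑ i, ∑ g : Fin d → Fin (2 * K + 1),
    D (boxVec (g - Pi.single i 1)) (boxVec g) * (B / h)
  have hM : ∀ x, gridDensity h κ K D x ≤ M := fun x => by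
    refine add_le_add_right (Finset.sum_le_sum fun i _ => Finset.sum_le_sum fun g _ => ?_) _
    exact mul_le_mul_of_nonneg_left (edgeWeight_le hh hB0 hB i g x) (hD.nonneg _ _)
  have hcont : Continuous fun x => 2 * Real.log (gridDensity h κ K D x) :=
    continuous_const.mul (continuous_gridDensity.log fun x => (hpos x).ne')
  refine ⟨BoundedContinuousFunction.ofNormedAddCommGroup _ hcont
    (2 * (|Real.log κ| + |Real.log M|)) fun x => ?_, fun x => ?_⟩
  · have h1 : Real.log κ ≤ Real.log (gridDensity h κ K D x) :=
      Real.log_le_log hκ (le_gridDensity hh hD x)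
    have h2 : Real.log (gridDensity h κ K D x) ≤ Real.log M := Real.log_le_log (hpos x) (hM x)
    rw [norm_mul, Real.norm_eq_abs, Real.norm_eq_abs, abs_two]
    gcongr
    rw [abs_le]
    constructor
    · linarith [neg_abs_le (Real.log κ), abs_nonneg (Real.log M)]
    · linarith [le_abs_self (Real.log M), abs_nonneg (Real.log κ)]
  · change Real.exp (2 * Real.log (gridDensity h κ K D x) / 2) = _
    rw [mul_div_cancel_left₀ _ two_ne_zero, Real.exp_log (hpos x)]

/-- The derivative contains only differences of `D p` across grid edges. By the triangle inequality
these are at most the `D`-lengths of the edges, which are the coefficients of the density. -/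
theorem abs_fderiv_interp_le (hh : 0 < h) (hκ : 0 ≤ κ) (hD : IsPMetric D) (p : Fin d → ℤ)
    (x v : EuclideanSpace ℝ (Fin d)) :
    |fderiv ℝ (interp h fun g : Fin d → Fin (2 * K + 1) => D p (boxVec g)) x v| ≤
      gridDensity h κ K D x * ‖v‖ := by
  rw [fderiv_interp, gridDensity, add_mul, Finset.sum_mul]
  refine (Finset.abs_sum_le_sum_abs _ _).trans ?_
  refine le_add_of_nonneg_of_le (by positivity) (Finset.sum_le_sum fun i _ => ?_)
  rw [abs_mul, mul_comm]
  refine mul_le_mul ?_ (PiLp.norm_apply_le v i) (abs_nonneg _)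
    (Finset.sum_nonneg fun g _ => mul_nonneg (hD.nonneg _ _) (edgeWeight_nonneg hh i g x))
  refine (Finset.abs_sum_le_sum_abs _ _).trans (Finset.sum_le_sum fun g _ => ?_)
  rw [abs_mul, abs_of_nonneg (edgeWeight_nonneg hh i g x), abs_sub_comm]
  exact mul_le_mul_of_nonneg_right
    ((hD.abs_sub_le _ _ _)) (edgeWeight_nonneg hh i g x)

theorem interp_sub_le_conformalDist (hh : 0 < h) (hκ : 0 ≤ κ) (hD : IsPMetric D)
    {f : EuclideanSpace ℝ (Fin d) →ᵇ ℝ} (hf : ∀ x, Real.exp (f x / 2) = gridDensity h κ K D x)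
    (p : Fin d → ℤ) (x y : EuclideanSpace ℝ (Fin d)) :
    interp h (fun g : Fin d → Fin (2 * K + 1) => D p (boxVec g)) y -
      interp h (fun g : Fin d → Fin (2 * K + 1) => D p (boxVec g)) x ≤ conformalDist f x y :=
  sub_le_conformalDist f (contDiff_interp _ _)
    (fun x v => hf x ▸ abs_fderiv_interp_le hh hκ hD p x v) x y

theorem sum_prod_bumpFun (x : Fin d → ℝ) :
    ∑ g : Fin d → Fin (2 * K + 1), ∏ i, bumpFun (g i) (x i) = 1 := by
  rw [← Fintype.prod_sum fun i (n : Fin (2 * K + 1)) => bumpFun n (x i)]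
  simp [sum_bumpFun]

/-- The interpolation of a function is a weighted mean of its values at the nearby grid points. -/
theorem interp_mem_Icc {x : EuclideanSpace ℝ (Fin d)} (hx : ∀ i, |x i / h| ≤ K)
    {u : (Fin d → Fin (2 * K + 1)) → ℝ} {a b : ℝ}
    (hu : ∀ g, (∀ i, |x i / h - boxVec g i| < 1) → u g ∈ Icc a b) : interp h u x ∈ Icc a b := by
  have hw : ∀ g : Fin d → Fin (2 * K + 1), 0 ≤ ∏ i, bumpFun (g i) (x i / h) := fun g =>
    Finset.prod_nonneg fun _ _ => bumpFun_nonneg _ _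
  have hzero : ∀ g : Fin d → Fin (2 * K + 1), (¬∀ i, |x i / h - boxVec g i| < 1) →
      ∏ i, bumpFun (g i) (x i / h) = 0 := fun g hg => by
    obtain ⟨i, hi⟩ := not_forall.1 hg
    exact Finset.prod_eq_zero (Finset.mem_univ i) (bumpFun_eq_zero (hx i) (not_lt.1 hi))
  have hsum := sum_prod_bumpFun (K := K) fun i => x i / h
  have hmul : ∀ c : ℝ, c = ∑ g : Fin d → Fin (2 * K + 1), c * ∏ i, bumpFun (g i) (x i / h) :=
    fun c => by rw [← Finset.mul_sum, hsum, mul_one]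
  constructor
  · rw [hmul a]
    refine Finset.sum_le_sum fun g _ => ?_
    by_cases hg : ∀ i, |x i / h - boxVec g i| < 1
    · exact mul_le_mul_of_nonneg_right (hu g hg).1 (hw g)
    · simp [hzero g hg]
  · rw [hmul b]
    refine Finset.sum_le_sum fun g _ => ?_
    by_cases hg : ∀ i, |x i / h - boxVec g i| < 1
    · exact mul_le_mul_of_nonneg_right (hu g hg).2 (hw g)
    · simp [hzero g hg]

/-- The sum factors over the coordinates: the bumps in the directions other than `i` sum to `1`, and
direction `i` leaves a sum of step derivatives. -/
theorem sum_edgeWeight_le (hh : 0 < h) {B : ℝ} (hB0 : 0 ≤ B)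
    (hB : ∀ t, deriv Real.smoothTransition t ≤ B) (i : Fin d) (x : EuclideanSpace ℝ (Fin d)) :
    ∑ g : Fin d → Fin (2 * K + 1), edgeWeight h i g x ≤ B / h := by
  have h1 : ∀ g : Fin d → Fin (2 * K + 1), edgeWeight h i g x =
      ∏ j, if j = i then stepDeriv (g j) (x j / h) / h else bumpFun (g j) (x j / h) := by
    intro g
    rw [← Finset.mul_prod_erase _ _ (Finset.mem_univ i), if_pos rfl, edgeWeight]
    congr 1
    exact Finset.prod_congr rfl fun j hj => by rw [if_neg (Finset.ne_of_mem_erase hj)]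
  simp only [h1]
  rw [← Fintype.prod_sum fun j (n : Fin (2 * K + 1)) =>
    if j = i then stepDeriv n (x j / h) / h else bumpFun n (x j / h),
    ← Finset.mul_prod_erase _ _ (Finset.mem_univ i)]
  rw [Finset.prod_eq_one fun j hj => by simp [Finset.ne_of_mem_erase hj, sum_bumpFun]]
  simp only [if_true, mul_one, ← Finset.sum_div]
  gcongr
  exact sum_stepDeriv_le hB0 hB _

/-- Only edges close to `x` carry weight at `x`, and the weights of each direction add up to at most
`B / h`. -/
theorem gridDensity_le (hh : 0 < h) {B : ℝ} (hB0 : 0 ≤ B)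
    (hB : ∀ t, deriv Real.smoothTransition t ≤ B) {x : EuclideanSpace ℝ (Fin d)}
    (hx : ∀ i, |x i / h| ≤ K) {δ : ℝ} (hδ0 : 0 ≤ δ)
    (hδ : ∀ v w : Fin d → ℤ, (∀ i, |x i / h - v i| < 2) → (∀ i, |x i / h - w i| < 2) →
      gridAdj v w → D v w ≤ δ) : gridDensity h κ K D x ≤ κ + d * (δ * (B / h)) := by
  have h1 : ∀ (i : Fin d) (g : Fin d → Fin (2 * K + 1)),
      D (boxVec (g - Pi.single i 1)) (boxVec g) * edgeWeight h i g x ≤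
        δ * edgeWeight h i g x := by
    intro i g
    by_cases h0 : edgeWeight h i g x = 0
    · simp [h0]
    refine mul_le_mul_of_nonneg_right ?_ (edgeWeight_nonneg hh i g x)
    unfold edgeWeight at h0
    rw [mul_eq_zero, not_or, div_eq_zero_iff, not_or, Finset.prod_eq_zero_iff] at h0
    obtain ⟨⟨h2, -⟩, h3⟩ := h0
    have hgi : g i ≠ 0 := fun h => h2 (by simp [stepDeriv, h])
    have h4 : (boxInt (g i) : ℝ) - 1 < x i / h := by
      by_contra hlt
      exact h2 (stepDeriv_of_le (not_lt.1 hlt))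
    have h5 : x i / h < boxInt (g i) := by
      by_contra hlt
      exact h2 (stepDeriv_of_ge (not_lt.1 hlt))
    have h6 : ∀ j, j ≠ i → |x j / h - boxInt (g j)| < 1 := fun j hj => by
      by_contra hlt
      exact h3 ⟨j, Finset.mem_erase.2 ⟨hj, Finset.mem_univ j⟩,
        bumpFun_eq_zero (hx j) (not_lt.1 hlt)⟩
    have h7 : boxInt (g i) = boxInt (g i - 1) + 1 := by
      have := boxInt_add_one (g := g i - 1) (by simpa using hgi)
      rwa [sub_add_cancel] at this
    have h8 : boxVec g = boxVec (g - Pi.single i 1) + Pi.single i 1 := by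
      funext j
      by_cases hj : j = i
      · subst hj; simpa [boxVec] using h7
      · simp [boxVec, hj]
    have h7' : (boxInt (g i) : ℝ) = boxInt (g i - 1) + 1 := by exact_mod_cast h7
    refine hδ _ _ (fun j => ?_) (fun j => ?_) ⟨i, Or.inl h8⟩
    · by_cases hj : j = i
      · subst hj
        simp only [boxVec, Pi.sub_apply, Pi.single_eq_same]
        rw [abs_lt]
        constructor <;> linarith
      · simp only [boxVec, Pi.sub_apply, Pi.single_eq_of_ne hj, sub_zero]
        linarith [h6 j hj]
    · by_cases hj : j = i
      · subst hj
        simp only [boxVec]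
        rw [abs_lt]
        constructor <;> linarith
      · simp only [boxVec]
        linarith [h6 j hj]
  unfold gridDensity
  refine add_le_add_right ?_ _
  calc ∑ i, ∑ g : Fin d → Fin (2 * K + 1),
        D (boxVec (g - Pi.single i 1)) (boxVec g) * edgeWeight h i g x
      ≤ ∑ _i : Fin d, δ * (B / h) := by
        refine Finset.sum_le_sum fun i _ => (Finset.sum_le_sum fun g _ => h1 i g).trans ?_
        rw [← Finset.mul_sum]
        exact mul_le_mul_of_nonneg_left (sum_edgeWeight_le hh hB0 hB i x) hδ0
    _ = d * (δ * (B / h)) := by simp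

/-- On an edge in direction `i` all other coordinates are grid values, where the step derivatives
vanish and the bumps are `0` or `1`. So no other edge contributes to the density there. -/
theorem gridDensity_edge (hh : 0 < h) {g : Fin d → Fin (2 * K + 1)} {i : Fin d} (hg : g i ≠ 0)
    (t : ℝ) (ht : t ∈ Icc (0 : ℝ) 1) :
    gridDensity h κ K D (gridPt h (boxVec (g - Pi.single i 1)) +
      t • EuclideanSpace.single i h) =
      κ + D (boxVec (g - Pi.single i 1)) (boxVec g) * (deriv Real.smoothTransition t / h) := by
  set x := gridPt h (boxVec (g - Pi.single i 1)) + t • EuclideanSpace.single i h with hx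
  have h7 : boxInt (g i) = boxInt (g i - 1) + 1 := by
    have := boxInt_add_one (g := g i - 1) (by simpa using hg)
    rwa [sub_add_cancel] at this
  have h7' : (boxInt (g i) : ℝ) = boxInt (g i - 1) + 1 := by exact_mod_cast h7
  have hxi : x i / h = boxInt (g i) - 1 + t := by
    rw [h7', hx]
    simp [boxVec]
    field_simp
  have hxj : ∀ j, j ≠ i → x j / h = boxInt (g j) := fun j hj => by
    rw [hx]
    simp [boxVec, hj]
    field_simp
  have hother : ∀ k, k ≠ i → ∀ g' : Fin d → Fin (2 * K + 1), edgeWeight h k g' x = 0 := by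
    intro k hk g'
    rw [edgeWeight, hxj k hk, stepDeriv_boxInt]
    simp
  have hne : ∀ g' : Fin d → Fin (2 * K + 1), g' ≠ g → edgeWeight h i g' x = 0 := by
    intro g' hg'
    obtain ⟨j, hj⟩ := Function.ne_iff.1 hg'
    rw [edgeWeight, mul_eq_zero]
    by_cases hji : j = i
    · subst hji
      left
      have hbne : boxInt (g' j) ≠ boxInt (g j) := fun h => hj (boxInt_injective h)
      rw [hxi, div_eq_zero_iff]
      left
      rcases lt_or_gt_of_ne hbne with hlt | hlt
      · refine stepDeriv_of_ge ?_
        have : (boxInt (g' j) : ℝ) ≤ boxInt (g j) - 1 := by exact_mod_cast Int.le_sub_one_of_lt hlt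
        linarith [ht.1]
      · refine stepDeriv_of_le ?_
        have : (boxInt (g j) : ℝ) ≤ boxInt (g' j) - 1 := by exact_mod_cast Int.le_sub_one_of_lt hlt
        linarith [ht.2]
    · right
      refine Finset.prod_eq_zero (Finset.mem_erase.2 ⟨hji, Finset.mem_univ j⟩) ?_
      rw [hxj j hji, bumpFun_boxInt, if_neg hj]
  have hself : edgeWeight h i g x = deriv Real.smoothTransition t / h := by
    rw [edgeWeight, hxi, Finset.prod_eq_one fun j hj => by
      rw [hxj j (Finset.ne_of_mem_erase hj), bumpFun_boxInt, if_pos rfl], mul_one, stepDeriv,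
      if_neg hg]
    congr 2
    ring
  rw [gridDensity, Finset.sum_eq_single i, Finset.sum_eq_single g, hself]
  · intro g' _ hg'
    rw [hne g' hg', mul_zero]
  · simp
  · intro k _ hk
    exact Finset.sum_eq_zero fun g' _ => by rw [hother k hk, mul_zero]
  · simp

/-- A grid edge has almost the prescribed length. -/
theorem conformalDist_gridEdge_le (hh : 0 < h) (hD : IsPMetric D)
    {f : EuclideanSpace ℝ (Fin d) →ᵇ ℝ} (hf : ∀ x, Real.exp (f x / 2) = gridDensity h κ K D x)
    {v w : Fin d → ℤ} (hv : ∀ i, |v i| ≤ K) (hw : ∀ i, |w i| ≤ K) (hadj : gridAdj v w) :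
    conformalDist f (gridPt h v) (gridPt h w) ≤ D v w + κ * h := by
  have key : ∀ (v w : Fin d → ℤ) (i : Fin d), (∀ i, |v i| ≤ K) → (∀ i, |w i| ≤ K) →
      w = v + Pi.single i 1 → conformalDist f (gridPt h v) (gridPt h w) ≤ D v w + κ * h := by
    intro v w i hv hw hvw
    choose g hg using fun j => exists_boxInt (hw j)
    have hgw : boxVec g = w := funext hg
    have hgi : g i ≠ 0 := fun h0 => by
      have h1 := boxInt_eq_neg_iff.2 h0
      rw [hg i, hvw] at h1
      have h2 := (abs_le.1 (hv i)).1
      simp at h1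
      omega
    have hgv : boxVec (g - Pi.single i 1) = v := by
      have h7 : boxInt (g i) = boxInt (g i - 1) + 1 := by
        have := boxInt_add_one (g := g i - 1) (by simpa using hgi)
        rwa [sub_add_cancel] at this
      funext j
      have h1 := congrFun hvw j
      rw [← hg j] at h1
      by_cases hj : j = i
      · subst hj
        simp [boxVec] at h1 ⊢
        omega
      · simp [boxVec, hj] at h1 ⊢
        omega
    have hpt : gridPt h w = gridPt h v + EuclideanSpace.single i h := by
      ext j
      rw [hvw]
      by_cases hj : j = i
      · subst hj; simp; ring
      · simp [hj]
    rw [hpt]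
    -- This is the density times the speed `h`. The transition function rises from `0` to `1`, so
    -- the integral is `κ * h + D v w`.
    have hcont : Continuous fun t => κ * h + D v w * deriv Real.smoothTransition t :=
      continuous_const.add (continuous_const.mul continuous_deriv_smoothTransition)
    refine (conformalDist_le_integral f _ _ hcont fun t ht => ?_).trans ?_
    · rw [hf, ← hgv, gridDensity_edge hh hgi t ht, hgv, hgw]
      simp only [PiLp.norm_single, Real.norm_eq_abs, abs_of_pos hh]
      refine le_of_eq ?_
      field_simp
    · have hint : IntervalIntegrable (fun t => D v w * deriv Real.smoothTransition t) volume 0 1 :=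
        (continuous_const.mul continuous_deriv_smoothTransition).intervalIntegrable _ _
      rw [intervalIntegral.integral_add intervalIntegrable_const hint,
        intervalIntegral.integral_const, intervalIntegral.integral_const_mul,
        intervalIntegral.integral_deriv_eq_sub
          (fun t _ => differentiable_smoothTransition t)
          (continuous_deriv_smoothTransition.intervalIntegrable _ _)]
      simp
      linarith
  obtain ⟨i, hi | hi⟩ := hadj
  · exact key v w i hv hw hi
  · rw [(conformalDist_isPMetric f).comm, hD.comm]
    exact key w v i hw hv hi

end Interpolation

/-! ### From a pseudometric on the grid to a conformal metric -/

section GridApproximation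

variable {d : ℕ} {h : ℝ} {D' : (Fin d → ℤ) → (Fin d → ℤ) → ℝ}

/-- A walk in the grid is a path for the conformal metric, of almost the same length. -/
theorem Reach.conformalDist_le (hh : 0 < h) (hD' : IsPMetric D') {v w : Fin d → ℤ} {r : ℝ}
    (hr : Reach gridAdj D' univ v w r) :
    ∃ n : ℕ, ∀ (K : ℕ) (κ : ℝ) (f : EuclideanSpace ℝ (Fin d) →ᵇ ℝ), n ≤ K → 0 ≤ κ →
      (∀ x, Real.exp (f x / 2) = gridDensity h κ K D' x) →
      conformalDist f (gridPt h v) (gridPt h w) ≤ r + n * (κ * h) := by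
  induction hr with
  | refl v r _ h0 =>
    refine ⟨0, fun K κ f _ _ _ => ?_⟩
    rw [(conformalDist_isPMetric f).self]
    simpa using h0
  | step v w z r r' _ hadj _ hle ih =>
    obtain ⟨n, hn⟩ := ih
    obtain ⟨K₀, hK₀⟩ : ∃ K₀ : ℕ, ∀ i, (v i).natAbs ≤ K₀ ∧ (w i).natAbs ≤ K₀ :=
      ⟨∑ i, ((v i).natAbs + (w i).natAbs), fun i => by
        have := Finset.single_le_sum (f := fun i => (v i).natAbs + (w i).natAbs)
          (fun i _ => Nat.zero_le _) (Finset.mem_univ i)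
        constructor <;> omega⟩
    -- One number serves two purposes: it bounds the number of edges, each of which costs an extra
    -- `κ * h`, and it makes the box large enough to contain the walk. It is fixed before `K` and
    -- `κ`.
    refine ⟨n + 1 + K₀, fun K κ f hK hκ hf => ?_⟩
    have h1 := hn K κ f (by omega) hκ hf
    have h2 := conformalDist_gridEdge_le hh hD' hf
      (fun i => by have := (hK₀ i).1; rw [Int.abs_eq_natAbs]; omega)
      (fun i => by have := (hK₀ i).2; rw [Int.abs_eq_natAbs]; omega) hadj
    have h3 := (conformalDist_isPMetric f).triangle (gridPt h v) (gridPt h w) (gridPt h z)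
    have h4 : 0 ≤ (K₀ : ℝ) * (κ * h) := by positivity
    push_cast
    linarith

theorem norm_le_of_abs_le {v : EuclideanSpace ℝ (Fin d)} {c : ℝ} (hv : ∀ i, |v i| ≤ c) :
    ‖v‖ ≤ d * c := by
  have h1 : v = ∑ i, EuclideanSpace.single i (v i) := by
    ext j
    simp [Pi.single_apply]
  calc ‖v‖ = ‖∑ i, EuclideanSpace.single i (v i)‖ := by rw [← h1]
    _ ≤ ∑ i, ‖EuclideanSpace.single i (v i)‖ := norm_sum_le _ _
    _ ≤ ∑ _i : Fin d, c := Finset.sum_le_sum fun i _ => by simpa using hv i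
    _ = d * c := by simp

/-- The nearest grid point. -/
noncomputable def gridRound (h : ℝ) (x : EuclideanSpace ℝ (Fin d)) : Fin d → ℤ :=
  fun i => round (x i / h)

theorem abs_sub_gridRound_le (hh : 0 < h) (x : EuclideanSpace ℝ (Fin d)) (i : Fin d) :
    |x i - h * gridRound h x i| ≤ h / 2 := by
  have h1 := abs_sub_round (x i / h)
  have h2 : x i - h * gridRound h x i = h * (x i / h - round (x i / h)) := by
    simp only [gridRound]
    field_simp
  rw [h2, abs_mul, abs_of_pos hh]
  nlinarith

theorem finite_setOf_abs_le (hh : 0 < h) (S : ℝ) :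
    {v : Fin d → ℤ | ∀ i, |h * v i| ≤ S}.Finite := by
  refine (Set.Finite.pi (t := fun _ : Fin d => Icc (-⌈S / h⌉) ⌈S / h⌉)
    fun _ => Set.finite_Icc _ _).subset fun v hv => ?_
  simp only [Set.mem_pi, mem_univ, forall_const, mem_Icc]
  intro i
  have h1 : |(v i : ℝ)| ≤ S / h := by
    rw [le_div_iff₀ hh, mul_comm]
    simpa [abs_mul, abs_of_pos hh] using hv i
  rw [← abs_le]
  have h2 : ((|v i| : ℤ) : ℝ) ≤ ⌈S / h⌉ := by
    push_cast
    exact h1.trans (Int.le_ceil _)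
  exact_mod_cast h2

/-- For the upper bound, `x` and `y` are joined to their nearest grid points by straight segments,
on which the density is controlled by `hloc` and `hreach`, and the grid points are joined by the
walk of `hreach`. For the lower bound, the interpolated `D'`-distance from the grid point nearest to
`x` is compared at `x`, where it is at most `2 * ε`, and at `y`, where it is at least `D x y - 3 *
ε`. -/
theorem exists_conformal_of_grid (hh : 0 < h) (hh4 : h ≤ 1 / 4)
    {D : EuclideanSpace ℝ (Fin d) → EuclideanSpace ℝ (Fin d) → ℝ} (hD : IsPMetric D)
    (hD' : IsPMetric D') {R ε B : ℝ} (hε : 0 < ε) (hB0 : 0 ≤ B)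
    (hB : ∀ t, deriv Real.smoothTransition t ≤ B)
    (hlow : ∀ v w : Fin d → ℤ, (∀ i, |h * v i| ≤ R + 1) → (∀ i, |h * w i| ≤ R + 1) →
      D (gridPt h v) (gridPt h w) - ε ≤ D' v w)
    (hreach : ∀ v w : Fin d → ℤ, (∀ i, |h * v i| ≤ R + 1) → (∀ i, |h * w i| ≤ R + 1) →
      Reach gridAdj D' univ v w (D (gridPt h v) (gridPt h w) + ε))
    (hloc : ∀ x y : EuclideanSpace ℝ (Fin d), (∀ i, |x i| ≤ R + 1) → (∀ i, |y i| ≤ R + 1) →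
      (∀ i, |x i - y i| ≤ 4 * h) → D x y ≤ ε) :
    ∃ f : EuclideanSpace ℝ (Fin d) →ᵇ ℝ, ∀ x y : EuclideanSpace ℝ (Fin d),
      (∀ i, |x i| ≤ R) → (∀ i, |y i| ≤ R) →
        |D x y - conformalDist f x y| ≤ (5 + 4 * d ^ 2 * B) * ε := by
  have hQ := finite_setOf_abs_le (d := d) hh (R + 1)
  set Q := {v : Fin d → ℤ | ∀ i, |h * v i| ≤ R + 1} with hQdef
  choose! n hn using fun v (hv : v ∈ Q) w (hw : w ∈ Q) =>
    (hreach v w hv hw).conformalDist_le hh hD'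
  obtain ⟨n₀, hn₀⟩ : ∃ n₀, ∀ v ∈ Q, ∀ w ∈ Q, n v w ≤ n₀ := by
    obtain ⟨n₀, hn₀⟩ := ((hQ.prod hQ).image fun p => n p.1 p.2).bddAbove
    exact ⟨n₀, fun v hv w hw => hn₀ ⟨(v, w), ⟨hv, hw⟩, rfl⟩⟩
  obtain ⟨K₁, hK₁⟩ := exists_nat_ge ((|R| + 1) / h)
  let K := max n₀ K₁
  -- The constant `κ` keeps the density positive. It is chosen after `n₀`, so that the walk and the
  -- two end segments together pay at most `ε` for it.
  let κ := ε / (h * (n₀ + 2 * d + 1))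
  have hκ : 0 < κ := by positivity
  have hκn : n₀ * (κ * h) + 2 * (d * (κ * h)) ≤ ε := by
    have h1 : κ * h * (n₀ + 2 * d + 1) = ε := by
      simp only [κ]
      field_simp
    have h2 : 0 ≤ κ * h := by positivity
    nlinarith
  obtain ⟨f, hf⟩ := exists_conformal_factor (K := K) hh hκ hD'
  have hK : ∀ x : EuclideanSpace ℝ (Fin d), (∀ i, |x i| ≤ R + 1) → ∀ i, |x i / h| ≤ K := by
    intro x hx i
    rw [abs_div, abs_of_pos hh]
    calc |x i| / h ≤ (|R| + 1) / h := by
          gcongr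
          linarith [hx i, le_abs_self R]
      _ ≤ K₁ := hK₁
      _ ≤ K := by exact_mod_cast le_max_right _ _
  -- grid points close to a point of the cube
  have hnear : ∀ x : EuclideanSpace ℝ (Fin d), (∀ i, |x i| ≤ R + h / 2) → ∀ v : Fin d → ℤ,
      (∀ i, |x i / h - v i| < 2) → v ∈ Q ∧ ∀ i, |x i - h * v i| ≤ 2 * h := by
    intro x hx v hv
    have h1 : ∀ i, |x i - h * v i| ≤ 2 * h := fun i => by
      have h2 : x i - h * v i = h * (x i / h - v i) := by field_simp
      rw [h2, abs_mul, abs_of_pos hh]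
      nlinarith [hv i]
    refine ⟨fun i => ?_, h1⟩
    have h3 := abs_sub_abs_le_abs_sub (h * v i) (x i)
    rw [abs_sub_comm] at h3
    linarith [hx i, h1 i]
  have hnear1 : ∀ x : EuclideanSpace ℝ (Fin d), (∀ i, |x i| ≤ R) → ∀ v : Fin d → ℤ,
      (∀ i, |x i / h - v i| < 1) → v ∈ Q ∧ ∀ i, |x i - h * v i| ≤ 2 * h := fun x hx v hv =>
    hnear x (fun i => by linarith [hx i]) v fun i => by linarith [hv i]
  have hround : ∀ x : EuclideanSpace ℝ (Fin d), (∀ i, |x i| ≤ R) → gridRound h x ∈ Q := by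
    intro x hx i
    have h3 := abs_sub_abs_le_abs_sub (h * gridRound h x i) (x i)
    rw [abs_sub_comm] at h3
    linarith [hx i, abs_sub_gridRound_le hh x i]
  have hround' : ∀ x : EuclideanSpace ℝ (Fin d), (∀ i, |x i| ≤ R) →
      D x (gridPt h (gridRound h x)) ≤ ε := fun x hx =>
    hloc _ _ (fun i => by linarith [hx i]) (hround x hx)
      fun i => (abs_sub_gridRound_le hh x i).trans (by linarith)
  have hD'le : ∀ v ∈ Q, ∀ w ∈ Q, D' v w ≤ D (gridPt h v) (gridPt h w) + ε := fun v hv w hw =>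
    (hreach v w hv hw).dist_le hD'
  have hdens : ∀ x : EuclideanSpace ℝ (Fin d), (∀ i, |x i| ≤ R + h / 2) →
      gridDensity h κ K D' x ≤ κ + d * (2 * ε * (B / h)) := by
    intro x hx
    refine gridDensity_le hh hB0 hB (hK x fun i => by linarith [hx i]) (by positivity) ?_
    intro v w hv hw _
    obtain ⟨hvQ, hv'⟩ := hnear x hx v hv
    obtain ⟨hwQ, hw'⟩ := hnear x hx w hw
    have h1 : D (gridPt h v) (gridPt h w) ≤ ε := hloc _ _ hvQ hwQ fun i => by
      have h2 := abs_sub_le (h * (v i : ℝ)) (x i) (h * w i)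
      rw [abs_sub_comm (h * (v i : ℝ)) (x i)] at h2
      simp only [gridPt_apply]
      linarith [hv' i, hw' i]
    linarith [hD'le v hvQ w hwQ]
  have hstart : ∀ x : EuclideanSpace ℝ (Fin d), (∀ i, |x i| ≤ R) →
      conformalDist f x (gridPt h (gridRound h x)) ≤ d * (κ * h) + 2 * d ^ 2 * B * ε := by
    intro x hx
    have hdiff : ∀ i, |(gridPt h (gridRound h x) - x) i| ≤ h / 2 := fun i => by
      have := abs_sub_gridRound_le hh x i
      rw [abs_sub_comm] at this
      simpa using this
    have h1 := conformalDist_le_of_bound f x (gridPt h (gridRound h x) - x)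
      (B := κ + d * (2 * ε * (B / h))) fun t ht => by
        rw [hf]
        refine hdens _ fun i => ?_
        have h2 : |t * (gridPt h (gridRound h x) - x) i| ≤ h / 2 := by
          rw [abs_mul, abs_of_nonneg ht.1]
          calc t * |(gridPt h (gridRound h x) - x) i| ≤ 1 * (h / 2) := by
                gcongr
                · exact ht.2
                · exact hdiff i
            _ = h / 2 := one_mul _
        calc |(x + t • (gridPt h (gridRound h x) - x)) i|
            = |x i + t * (gridPt h (gridRound h x) - x) i| := by simp
          _ ≤ |x i| + |t * (gridPt h (gridRound h x) - x) i| := abs_add_le _ _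
          _ ≤ R + h / 2 := add_le_add (hx i) h2
    rw [add_sub_cancel] at h1
    refine h1.trans ?_
    have h3 := norm_le_of_abs_le hdiff
    calc (κ + d * (2 * ε * (B / h))) * ‖gridPt h (gridRound h x) - x‖
        ≤ (κ + d * (2 * ε * (B / h))) * (d * h) := by
          gcongr
          refine h3.trans ?_
          gcongr
          linarith
      _ = d * (κ * h) + 2 * d ^ 2 * B * ε := by field_simp
  refine ⟨f, fun x y hx hy => ?_⟩
  have hPD := conformalDist_isPMetric f
  have hxQ := hround x hx
  have hyQ := hround y hy
  rw [abs_le]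
  constructor
  -- Upper bound for the conformal distance.
  · have h1 := hn _ hxQ _ hyQ K κ f ((hn₀ _ hxQ _ hyQ).trans (le_max_left _ _)) hκ.le hf
    have h2 : (n (gridRound h x) (gridRound h y) : ℝ) * (κ * h) ≤ n₀ * (κ * h) := by
      gcongr
      exact hn₀ _ hxQ _ hyQ
    have h3 := hPD.triangle x (gridPt h (gridRound h x)) y
    have h4 := hPD.triangle (gridPt h (gridRound h x)) (gridPt h (gridRound h y)) y
    rw [hPD.comm (gridPt h (gridRound h y)) y] at h4
    have h5 := hD.triangle (gridPt h (gridRound h x)) x (gridPt h (gridRound h y))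
    have h6 := hD.triangle x y (gridPt h (gridRound h y))
    rw [hD.comm _ x] at h5
    linarith [hstart x hx, hstart y hy, hround' x hx, hround' y hy]
  -- Lower bound for the conformal distance.
  · have h1 := interp_sub_le_conformalDist (K := K) hh hκ.le hD' hf (gridRound h x) x y
    have hUx := interp_mem_Icc (h := h) (hK x fun i => by linarith [hx i])
      (u := fun g => D' (gridRound h x) (boxVec g)) (a := 0) (b := 2 * ε) fun g hg => by
        obtain ⟨hgQ, hg'⟩ := hnear1 x hx _ hg
        refine ⟨hD'.nonneg _ _, ?_⟩
        have h2 : D (gridPt h (gridRound h x)) (gridPt h (boxVec g)) ≤ ε :=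
          hloc _ _ hxQ hgQ fun i => by
            have h2 := abs_sub_le (h * (gridRound h x i : ℝ)) (x i) (h * boxVec g i)
            rw [abs_sub_comm (h * (gridRound h x i : ℝ)) (x i)] at h2
            simp only [gridPt_apply]
            linarith [hg' i, abs_sub_gridRound_le hh x i]
        linarith [hD'le _ hxQ _ hgQ]
    have hUy := interp_mem_Icc (h := h) (hK y fun i => by linarith [hy i])
      (u := fun g => D' (gridRound h x) (boxVec g)) (a := D x y - 3 * ε)
      (b := D x y + 3 * ε) fun g hg => by
        obtain ⟨hgQ, hg'⟩ := hnear1 y hy _ hg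
        have h2 : D y (gridPt h (boxVec g)) ≤ ε :=
          hloc _ _ (fun i => by linarith [hy i]) hgQ fun i => by
            simp only [gridPt_apply]
            linarith [hg' i]
        have h3 := hround' x hx
        have h4 := hD'le _ hxQ _ hgQ
        have h5 := hlow _ _ hxQ hgQ
        have h6 := hD.triangle x (gridPt h (gridRound h x)) y
        have h7 := hD.triangle (gridPt h (gridRound h x)) (gridPt h (boxVec g)) y
        have h8 := hD.triangle (gridPt h (gridRound h x)) x (gridPt h (boxVec g))
        have h9 := hD.triangle x y (gridPt h (boxVec g))
        rw [hD.comm (gridPt h (boxVec g)) y] at h7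
        rw [hD.comm _ x] at h8
        constructor <;> linarith
    have h3 : 0 ≤ 4 * (d : ℝ) ^ 2 * B * ε := by positivity
    linarith [hUx.2, hUy.1]

end GridApproximation

/-! ### From the `D`-topology to the given topology -/

namespace IsMetric

variable {X : Type*} {D : X → X → ℝ}

theorem continuous_of_inducesTopology [t : TopologicalSpace X] (h : IsMetric D)
    (ht : h.InducesTopology) : Continuous fun p : X × X => D p.1 p.2 := by
  have h1 : @Continuous (X × X) ℝ (@instTopologicalSpaceProd X X h.topology h.topology) _
      fun p : X × X => D p.1 p.2 := by
    let := h.metricSpace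
    exact continuous_dist
  unfold InducesTopology at ht
  rwa [ht] at h1

theorem isCompact_closedBall [t : TopologicalSpace X] (h : IsMetric D)
    (ht : h.InducesTopology) (hc : h.BoundedlyCompact) (x : X) (r : ℝ) :
    IsCompact {y | D x y ≤ r} := by
  have h1 : @IsCompact X h.topology {y | D x y ≤ r} := by
    let := h.metricSpace
    have : ProperSpace X := hc
    have h2 := ProperSpace.isCompact_closedBall x r
    have h3 : Metric.closedBall x r = {y | D x y ≤ r} := by
      ext y
      rw [Metric.mem_closedBall, dist_comm]
      rfl
    rwa [h3] at h2
  unfold InducesTopology at ht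
  rwa [ht] at h1

theorem IsLengthMetric.exists_almost_shortest_path {h : IsMetric D} (hl : h.IsLengthMetric)
    (x y : X) {δ : ℝ} (hδ : 0 < δ) :
    ∃ γ : ℝ → X, @Continuous ℝ X _ h.topology γ ∧ γ 0 = x ∧ γ 1 = y ∧
      ∀ (n : ℕ) (u : ℕ → ℝ), Monotone u →
        ∑ i ∈ Finset.range n, D (γ (u i)) (γ (u (i + 1))) ≤ D x y + δ := by
  let := h.metricSpace
  have hpos : 0 ≤ D x y := h.isPMetric.nonneg x y
  have hlt : (⨅ γ : Path x y, pathLength γ) < ENNReal.ofReal (D x y + δ) := by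
    rw [← hl x y, edist_dist]
    exact (ENNReal.ofReal_lt_ofReal_iff (by linarith)).2 (show D x y < D x y + δ by linarith)
  obtain ⟨p, hp⟩ := iInf_lt_iff.1 hlt
  refine ⟨p.extend, p.continuous_extend, p.extend_zero, p.extend_one, fun n u hu => ?_⟩
  -- The extended path is constant outside `[0, 1]`, so the points of any monotone sequence may be
  -- projected to `[0, 1]`.
  have h2 := eVariationOn.sum_le (f := p) (s := univ) (n := n)
    (u := fun i => projIcc (0 : ℝ) 1 zero_le_one (u i))
    (fun i j hij => monotone_projIcc _ (hu hij)) (fun i => mem_univ _)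
  have h3 : ENNReal.ofReal (∑ i ∈ Finset.range n,
      D (p.extend (u i)) (p.extend (u (i + 1)))) ≤ ENNReal.ofReal (D x y + δ) := by
    rw [ENNReal.ofReal_sum_of_nonneg fun i _ => h.isPMetric.nonneg _ _]
    refine le_trans (le_of_eq (Finset.sum_congr rfl fun i _ => ?_)) (h2.trans hp.le)
    rw [edist_comm, edist_dist]
    rfl
  exact (ENNReal.ofReal_le_ofReal_iff (by linarith)).1 h3

/-- Any two points are joined by paths that are almost as short as their distance. -/
theorem exists_almost_shortest_path [t : TopologicalSpace X] (h : IsMetric D)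
    (ht : h.InducesTopology) (hl : h.IsLengthMetric) (x y : X) {δ : ℝ} (hδ : 0 < δ) :
    ∃ γ : ℝ → X, Continuous γ ∧ γ 0 = x ∧ γ 1 = y ∧ ∀ (n : ℕ) (u : ℕ → ℝ), Monotone u →
      ∑ i ∈ Finset.range n, D (γ (u i)) (γ (u (i + 1))) ≤ D x y + δ := by
  have h1 := hl.exists_almost_shortest_path x y hδ
  unfold InducesTopology at ht
  rwa [ht] at h1

end IsMetric

/-! ### Almost shortest paths become almost geodesic grid walks -/

section Discretization

variable {d : ℕ} {D : EuclideanSpace ℝ (Fin d) → EuclideanSpace ℝ (Fin d) → ℝ}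

/-- Uniform continuity is used on a thickening of `S`, since `y` need not belong to `S`. Dividing by
`d + 1` passes from coordinatewise to Euclidean closeness. -/
theorem exists_modulus (hD : IsPMetric D)
    (hc : Continuous fun p : EuclideanSpace ℝ (Fin d) × EuclideanSpace ℝ (Fin d) => D p.1 p.2)
    {S : Set (EuclideanSpace ℝ (Fin d))} (hS : IsCompact S) {η : ℝ} (hη : 0 < η) :
    ∃ τ > 0, ∀ x ∈ S, ∀ y, (∀ i, |x i - y i| ≤ τ) → D x y ≤ η := by
  have hS' := hS.cthickening (r := 1)
  have huc := (hS'.prod hS').uniformContinuousOn_of_continuous hc.continuousOn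
  obtain ⟨τ, hτ, H⟩ := Metric.uniformContinuousOn_iff.1 huc η hη
  have hpos : 0 < min τ 1 / (d + 1) := by positivity
  refine ⟨_, hpos, fun x hx y hxy => ?_⟩
  have h1 : dist x y < min τ 1 := by
    rw [dist_eq_norm]
    refine (norm_le_of_abs_le (v := x - y) hxy).trans_lt ?_
    rw [← mul_div_assoc, div_lt_iff₀ (by positivity), mul_comm]
    have : 0 < min τ 1 := by positivity
    nlinarith
  have hx' : x ∈ Metric.cthickening 1 S := Metric.self_subset_cthickening S hx
  have hy' : y ∈ Metric.cthickening 1 S :=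
    Metric.mem_cthickening_of_dist_le y x 1 S hx (by
      rw [dist_comm]
      exact (h1.trans_le (min_le_right _ _)).le)
  have h2 := H (x, y) ⟨hx', hy'⟩ (x, x) ⟨hx', hx'⟩ (by
    rw [Prod.dist_eq]
    simp only [dist_self]
    rw [max_eq_right dist_nonneg, dist_comm]
    exact h1.trans_le (min_le_left _ _))
  rw [Real.dist_eq] at h2
  simp only [hD.self, sub_zero] at h2
  exact (le_abs_self _).trans h2.le

theorem abs_sub_le_gridDist (v w : Fin d → ℤ) (i : Fin d) : |(v i : ℝ) - w i| ≤ gridDist v w := by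
  have h1 : (v i - w i).natAbs ≤ gridDist v w :=
    Finset.single_le_sum (f := fun i => (v i - w i).natAbs) (fun _ _ => Nat.zero_le _)
      (Finset.mem_univ i)
  have h2 : |v i - w i| ≤ (gridDist v w : ℤ) := by
    rw [Int.abs_eq_natAbs]
    exact_mod_cast h1
  exact_mod_cast h2

theorem gridDist_le {v w : Fin d → ℤ} {c : ℝ} (h : ∀ i, |(v i : ℝ) - w i| ≤ c) :
    (gridDist v w : ℝ) ≤ d * c := by
  rw [gridDist]
  push_cast
  calc ∑ i, (((v i - w i).natAbs : ℕ) : ℝ) ≤ ∑ _i : Fin d, c := by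
        refine Finset.sum_le_sum fun i _ => ?_
        have h1 : (((v i - w i).natAbs : ℕ) : ℝ) = |(v i : ℝ) - w i| := by
          rw [Nat.cast_natAbs]
          push_cast
          rfl
        rw [h1]
        exact h i
    _ = d * c := by simp

/-- On a fine grid, an almost shortest path can be replaced by an almost geodesic grid walk. -/
theorem exists_isAlmostGeodesic (hD : IsPMetric D)
    (hc : Continuous fun p : EuclideanSpace ℝ (Fin d) × EuclideanSpace ℝ (Fin d) => D p.1 p.2)
    {γ : ℝ → EuclideanSpace ℝ (Fin d)} (hγ : Continuous γ) {δ : ℝ} (hδ : 0 < δ)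
    (hlen : ∀ (n : ℕ) (u : ℕ → ℝ), Monotone u →
      ∑ i ∈ Finset.range n, D (γ (u i)) (γ (u (i + 1))) ≤ D (γ 0) (γ 1) + δ) :
    ∃ h₀ > 0, ∀ h, 0 < h → h ≤ h₀ → ∃ (N : ℕ) (b : ℕ → Fin d → ℤ) (s : ℕ → ℝ),
      IsAlmostGeodesic gridAdj (fun v w => D (gridPt h v) (gridPt h w)) (3 * δ) N b s ∧
        b 0 = gridRound h (γ 0) ∧ b N = gridRound h (γ 1) := by
  obtain ⟨τ, hτ, hmod⟩ := exists_modulus hD hc ((isCompact_Icc (a := (0 : ℝ)) (b := 1)).image hγ) hδ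
  -- The grid points used between the roundings of two consecutive points of the curve are within
  -- `(2 * d + 3 / 2) * h` of the first of these points, in each coordinate.
  refine ⟨τ / (2 * d + 2), by positivity, fun h hh hh₀ => ?_⟩
  rw [le_div_iff₀ (by positivity)] at hh₀
  obtain ⟨ρ, hρ, hunif⟩ := Metric.uniformContinuousOn_iff.1
    ((isCompact_Icc (a := (0 : ℝ)) (b := 1)).uniformContinuousOn_of_continuous hγ.continuousOn) h hh
  obtain ⟨M, hM⟩ := exists_nat_gt (1 / ρ)
  have hM0 : (0 : ℝ) < M := lt_trans (by positivity) hM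
  let x : ℕ → EuclideanSpace ℝ (Fin d) := fun k => γ (k / M)
  let S : ℕ → ℝ := fun k => ∑ i ∈ Finset.range k, D (x i) (x (i + 1))
  have hIcc : ∀ k ≤ M, (k / M : ℝ) ∈ Icc (0 : ℝ) 1 := fun k hk =>
    ⟨by positivity, (div_le_one hM0).2 (by exact_mod_cast hk)⟩
  have hxmem : ∀ k ≤ M, x k ∈ γ '' Icc 0 1 := fun k hk => ⟨_, hIcc k hk, rfl⟩
  have hxstep : ∀ k < M, ∀ i, |x k i - x (k + 1) i| ≤ h := by
    intro k hk i
    have h1 : dist (x k) (x (k + 1)) < h := by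
      refine hunif _ (hIcc k hk.le) _ (hIcc (k + 1) hk) ?_
      have h2 : (k / M : ℝ) - ((k + 1 : ℕ) : ℝ) / M = -(1 / M) := by
        push_cast
        ring
      rw [Real.dist_eq, h2, abs_neg, abs_of_pos (by positivity), div_lt_comm₀ hM0 hρ]
      exact hM
    rw [dist_eq_norm] at h1
    exact (PiLp.norm_apply_le (x k - x (k + 1)) i).trans h1.le
  have hS : ∀ k l, k ≤ l → D (x k) (x l) ≤ S l - S k := by
    intro k l hkl
    induction l, hkl using Nat.le_induction with
    | base => simp [hD.self]
    | succ l hkl ih =>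
      have h1 : S (l + 1) = S l + D (x l) (x (l + 1)) := Finset.sum_range_succ _ _
      linarith [hD.triangle (x k) (x l) (x (l + 1))]
  have hSM : S M ≤ D (x 0) (x M) + δ := by
    have h1 := hlen M (fun k => k / M) fun i j hij => by
      dsimp only
      gcongr
    have h2 : x 0 = γ 0 := by simp [x]
    have h3 : x M = γ 1 := by simp [x, hM0.ne']
    rw [h2, h3]
    exact h1
  have hS' : ∀ k l, k ≤ l → l ≤ M → S l - S k ≤ D (x k) (x l) + δ := by
    intro k l hkl hl
    have h1 := hS 0 k (Nat.zero_le _)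
    have h2 := hS l M hl
    have h3 : S 0 = 0 := by simp [S]
    linarith [hD.triangle (x 0) (x k) (x M), hD.triangle (x k) (x l) (x M)]
  -- A grid point may carry the time `S k`, the length of the polygon up to `x k`, if it is
  -- `D`-close to `x k`. Between two such points, `2 * δ` is lost by the displacements and `δ` by
  -- the excess length of the curve.
  let P : (Fin d → ℤ) → ℝ → Prop := fun v s => ∃ k ≤ M, s = S k ∧ D (x k) (gridPt h v) ≤ δ
  have hround : ∀ k i, |x k i - h * gridRound h (x k) i| ≤ h / 2 := fun k i =>
    abs_sub_gridRound_le hh (x k) i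
  have hhτ : h ≤ τ := by nlinarith [show (0 : ℝ) ≤ d from Nat.cast_nonneg d]
  have hP0 : ∀ k ≤ M, P (gridRound h (x k)) (S k) := fun k hk =>
    ⟨k, hk, rfl, hmod _ (hxmem k hk) _ fun i => (hround k i).trans (by linarith)⟩
  have hPstep : ∀ k < M, ∀ u, gridDist u (gridRound h (x (k + 1))) ≤
      gridDist (gridRound h (x k)) (gridRound h (x (k + 1))) → P u (S k) := by
    intro k hk u hu
    refine ⟨k, hk.le, rfl, hmod _ (hxmem k hk.le) _ fun i => ?_⟩
    have h1 : (gridDist (gridRound h (x k)) (gridRound h (x (k + 1))) : ℝ) ≤ d * 2 := by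
      refine gridDist_le fun j => ?_
      have h2 : h * |(gridRound h (x k) j : ℝ) - gridRound h (x (k + 1)) j| ≤ h * 2 := by
        rw [← abs_of_pos hh, ← abs_mul, abs_of_pos hh, mul_sub]
        have h3 := abs_le.1 (hround k j)
        have h4 := abs_le.1 (hround (k + 1) j)
        have h5 := abs_le.1 (hxstep k hk j)
        rw [abs_le]
        constructor <;> linarith
      exact le_of_mul_le_mul_left h2 hh
    have h6 : |(u i : ℝ) - gridRound h (x (k + 1)) i| ≤ d * 2 :=
      (abs_sub_le_gridDist _ _ i).trans (le_trans (by exact_mod_cast hu) h1)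
    have h7 : |h * (u i : ℝ) - h * gridRound h (x (k + 1)) i| ≤ h * (d * 2) := by
      rw [← mul_sub, abs_mul, abs_of_pos hh]
      gcongr
    have h4 := abs_le.1 (hround (k + 1) i)
    have h5 := abs_le.1 (hxstep k hk i)
    have h8 := abs_le.1 h7
    rw [gridPt_apply, abs_le]
    constructor <;> nlinarith
  obtain ⟨n, b, s, hb0, hbn, hbP, hadj, hmono, hne⟩ := exists_simple_timed_grid_walk
    (fun k hk => by linarith [hS k (k + 1) (Nat.le_succ k), hD.nonneg (x k) (x (k + 1))]) hP0 hPstep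
  have hx0 : x 0 = γ 0 := by simp [x]
  have hxM : x M = γ 1 := by simp [x, hM0.ne']
  rw [hx0] at hb0
  rw [hxM] at hbn
  have hclose : ∀ i j, i ≤ j → j ≤ n →
      |(s j - s i) - D (gridPt h (b i)) (gridPt h (b j))| ≤ 3 * δ := by
    intro i j hij hj
    have hle := hmono i j hij hj
    obtain ⟨k, hk, hsk, hDk⟩ := hbP i (hij.trans hj)
    obtain ⟨l, hl, hsl, hDl⟩ := hbP j hj
    have h1 : D (x k) (x l) ≤ s j - s i ∧ s j - s i ≤ D (x k) (x l) + δ := by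
      rw [hsk, hsl] at hle ⊢
      rcases le_total k l with hkl | hkl
      · exact ⟨hS k l hkl, hS' k l hkl hl⟩
      -- The order of the times does not fix the order of the indices. But if `l ≤ k` while `S k ≤ S
      -- l`, then `S k = S l`, and `D (x l) (x k)` vanishes.
      · have h2 := hS l k hkl
        have h3 := hD.nonneg (x l) (x k)
        rw [hD.comm (x k)]
        constructor <;> linarith
    have h4 := hD.triangle (gridPt h (b i)) (x k) (gridPt h (b j))
    have h5 := hD.triangle (x k) (x l) (gridPt h (b j))
    have h6 := hD.triangle (x k) (gridPt h (b i)) (x l)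
    have h7 := hD.triangle (gridPt h (b i)) (gridPt h (b j)) (x l)
    rw [hD.comm (gridPt h (b i)) (x k)] at h4
    rw [hD.comm (gridPt h (b j)) (x l)] at h7
    rw [abs_le]
    constructor <;> linarith [h1.1, h1.2]
  refine ⟨n, b, s, ⟨hne, hmono, fun i j hij hj => ?_, fun i j hij hj => ?_, hadj⟩, hb0, hbn⟩
  · linarith [(abs_le.1 (hclose i j hij hj)).1]
  · linarith [(abs_le.1 (hclose i j hij hj)).2]

end Discretization

/-! ### Nets, chains and the choice of constants -/

section Assembly

/-- If nearby points of a net are joined by short walks, so are distant ones. -/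
theorem reach_of_reach_nearby {X V : Type*} {D : X → X → ℝ} (hD : IsPMetric D)
    {adj : V → V → Prop} {d : V → V → ℝ} {H : Set V} {pt : X → V} {𝒩 : Set X} {η σ Λ : ℝ}
    {k₀ : ℕ} {x₀ : X} (hη : 0 ≤ η) (hησ : 2 * η ≤ σ)
    (hmid : ∀ x y, σ ≤ D x y → ∃ z, D x z = σ ∧ D z y ≤ D x y - σ + η)
    (hnet : ∀ z, D x₀ z ≤ Λ + k₀ * (σ / 2) → ∃ p ∈ 𝒩, D z p ≤ η)
    (hshort : ∀ p ∈ 𝒩, ∀ q ∈ 𝒩, D p q ≤ σ + 2 * η → Reach adj d H (pt p) (pt q) (D p q + 3 * η))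
    (k : ℕ) : k ≤ k₀ → ∀ x y p q, D x₀ y ≤ Λ → D x y ≤ k * (σ / 2) → p ∈ 𝒩 → q ∈ 𝒩 →
      D x p ≤ η → D y q ≤ η → Reach adj d H (pt p) (pt q) (D x y + 6 * η * (k + 1)) := by
  have hnear : ∀ x y p q, D x y ≤ σ → p ∈ 𝒩 → q ∈ 𝒩 → D x p ≤ η → D y q ≤ η →
      Reach adj d H (pt p) (pt q) (D x y + 5 * η) := by
    intro x y p q hxy hp hq hxp hyq
    have h1 := hD.triangle p x q
    have h2 := hD.triangle x y q
    rw [hD.comm p x] at h1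
    exact (hshort p hp q hq (by linarith)).mono_cost (by linarith)
  induction k with
  | zero =>
    intro _ x y p q _ hxy hp hq hxp hyq
    refine (hnear x y p q ?_ hp hq hxp hyq).mono_cost ?_
    · push_cast at hxy
      linarith
    · push_cast
      linarith
  | succ k ih =>
    intro hk x y p q hy hxy hp hq hxp hyq
    have hkη : 0 ≤ (k : ℝ) * η := by positivity
    rcases le_or_gt (D x y) σ with hσ | hσ
    · exact (hnear x y p q hσ hp hq hxp hyq).mono_cost (by push_cast; linarith)
    -- Splitting off a step of length `σ` shortens the remaining distance by at least `σ - η ≥ σ /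
    -- 2`, which is what the induction on `k` needs. The step costs `5 * η` through `hnear` and `η`
    -- through `hmid`.
    obtain ⟨z, hxz, hzy⟩ := hmid x y hσ.le
    have hk' : ((k + 1 : ℕ) : ℝ) * (σ / 2) ≤ k₀ * (σ / 2) := by
      have : 0 ≤ σ / 2 := by linarith
      gcongr
    obtain ⟨p', hp', hzp'⟩ := hnet z (by
      have := hD.triangle x₀ y z
      rw [hD.comm y z] at this
      linarith)
    have h1 := ih (by omega) z y p' q hy (by push_cast at hxy; linarith) hp' hq hzp' hyq
    refine ((hnear x z p p' hxz.le hp hp' hxp hzp').trans h1).mono_cost ?_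
    push_cast
    linarith

/-- The start of the gluings: raising the distance of all distinct points by `E` provides the slack,
whatever `H` is. -/
theorem shortcut_add_const {V : Type*} [DecidableEq V] {D : V → V → ℝ} (hD : IsPMetric D)
    (H : Set V) {a E : ℝ} (ha : 0 ≤ a) (hE : 0 ≤ E) :
    Shortcut D (fun x y => if x = y then 0 else D x y + E) H a E where
  isPMetric := by
    refine ⟨fun x => by simp, fun x y => ?_, fun x y z => ?_⟩
    · simp only [eq_comm (a := x), hD.comm x]
    · have h1 := hD.triangle x y z
      have h2 := hD.nonneg x y
      have h3 := hD.nonneg y z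
      split_ifs <;> subst_vars <;> first | linarith | simp_all
  le x y := by
    split_ifs
    · linarith [hD.nonneg x y]
    · exact le_rfl
  lower x y := by
    split_ifs with h
    · subst h; rw [hD.self]; linarith
    · linarith
  far x y hxy _ := by
    rw [if_neg hxy]
    linarith

variable {d : ℕ} {D : EuclideanSpace ℝ (Fin d) → EuclideanSpace ℝ (Fin d) → ℝ}

/-- The shortcut construction along almost geodesics between the points of a finite net. -/
theorem exists_grid_shortcut (hD : IsPMetric D)
    (hc : Continuous fun p : EuclideanSpace ℝ (Fin d) × EuclideanSpace ℝ (Fin d) => D p.1 p.2)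
    (hpath : ∀ x y, ∀ δ > 0, ∃ γ : ℝ → EuclideanSpace ℝ (Fin d), Continuous γ ∧ γ 0 = x ∧
      γ 1 = y ∧ ∀ (n : ℕ) (u : ℕ → ℝ), Monotone u →
        ∑ i ∈ Finset.range n, D (γ (u i)) (γ (u (i + 1))) ≤ D x y + δ)
    (𝒩 : Finset (EuclideanSpace ℝ (Fin d))) {ε₁ η : ℝ} (hη : 0 < η) :
    ∃ h₀ > 0, ∀ h, 0 < h → h ≤ h₀ → ∃ (D' : (Fin d → ℤ) → (Fin d → ℤ) → ℝ)
      (H : Set (Fin d → ℤ)), IsPMetric D' ∧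
      (∀ v w, D (gridPt h v) (gridPt h w) - η ≤ D' v w) ∧
      (∀ p ∈ 𝒩, gridRound h p ∈ H) ∧
      (∀ p ∈ 𝒩, ∀ q ∈ 𝒩, D p q ≤ ε₁ →
        Reach gridAdj D' H (gridRound h p) (gridRound h q) (D p q + 3 * η)) ∧
      (∀ p ∈ 𝒩, D p (gridPt h (gridRound h p)) ≤ η) ∧
      ∀ v ∈ H, v ∈ gridRound h '' (𝒩 : Set (EuclideanSpace ℝ (Fin d))) ∨ ∃ p ∈ 𝒩,
        Reach gridAdj D' H (gridRound h p) v (ε₁ + 3 * η) := by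
  classical
  -- Only close pairs are joined, so that every vertex on the walks stays close to the net.
  let pairs := (𝒩 ×ˢ 𝒩).filter fun p => D p.1 p.2 ≤ ε₁
  let m := pairs.card
  -- The constant `C` depends only on the number of pairs and the size of the net, so the precision
  -- of the almost geodesics, and then the mesh, can be adapted to it.
  obtain ⟨C, hC1, n', HC⟩ := exists_shortcut_along_family m 𝒩.card
  have hC0 : 0 < C := by linarith
  have hδ : 0 < η / (3 * C) := by positivity
  have hgeo : ∀ p : EuclideanSpace ℝ (Fin d) × EuclideanSpace ℝ (Fin d), ∃ h₀ > 0,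
      ∀ h, 0 < h → h ≤ h₀ → ∃ (N : ℕ) (b : ℕ → Fin d → ℤ) (s : ℕ → ℝ),
        IsAlmostGeodesic gridAdj (fun v w => D (gridPt h v) (gridPt h w)) (3 * (η / (3 * C))) N b s ∧
          b 0 = gridRound h p.1 ∧ b N = gridRound h p.2 := by
    intro p
    obtain ⟨γ, hγ, h0, h1, hlen⟩ := hpath p.1 p.2 _ hδ
    rw [← h0, ← h1] at hlen ⊢
    exact exists_isAlmostGeodesic hD hc hγ hδ hlen
  choose h₁ hh₁ hgeo using hgeo
  obtain ⟨h₂, hh₂, hmin⟩ : ∃ h₂ > 0, ∀ p ∈ pairs, h₂ ≤ h₁ p := by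
    rcases pairs.eq_empty_or_nonempty with he | hne
    · exact ⟨1, one_pos, by simp [he]⟩
    · obtain ⟨p, -, hp⟩ := pairs.exists_min_image h₁ hne
      exact ⟨h₁ p, hh₁ p, hp⟩
  obtain ⟨τ, hτ, hmod⟩ := exists_modulus hD hc 𝒩.finite_toSet.isCompact hη
  refine ⟨min h₂ τ, lt_min hh₂ hτ, fun h hh hle => ?_⟩
  have hDh := hD.comp (gridPt (d := d) h)
  have hround : ∀ p ∈ 𝒩, D p (gridPt h (gridRound h p)) ≤ η := fun p hp =>
    hmod p hp _ fun i => (abs_sub_gridRound_le hh p i).trans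
      (by linarith [hle.trans (min_le_right _ _)])
  let e := 3 * (η / (3 * C))
  have he : C * e = η := by
    simp only [e]
    field_simp
  have he0 : 0 ≤ e := by positivity
  let pr : ℕ → EuclideanSpace ℝ (Fin d) × EuclideanSpace ℝ (Fin d) := fun i =>
    if hi : i < m then pairs.equivFin.symm ⟨i, hi⟩ else 0
  have hpr : ∀ i < m, pr i ∈ pairs := fun i hi => by
    simp only [pr, dif_pos hi]
    exact (pairs.equivFin.symm ⟨i, hi⟩).2
  have hpr' : ∀ p ∈ pairs, ∃ i < m, pr i = p := fun p hp => by
    refine ⟨pairs.equivFin ⟨p, hp⟩, (pairs.equivFin ⟨p, hp⟩).2, ?_⟩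
    simp [pr, m]
  have hwalk : ∀ i, ∃ (N : ℕ) (b : ℕ → Fin d → ℤ) (s : ℕ → ℝ), i < m →
      IsAlmostGeodesic gridAdj (fun v w => D (gridPt h v) (gridPt h w)) e N b s ∧
        b 0 = gridRound h (pr i).1 ∧ b N = gridRound h (pr i).2 := by
    intro i
    by_cases hi : i < m
    · obtain ⟨N, b, s, H⟩ := hgeo (pr i) h hh
        ((hle.trans (min_le_left _ _)).trans (hmin _ (hpr i hi)))
      exact ⟨N, b, s, fun _ => H⟩
    · exact ⟨0, fun _ => 0, fun _ => 0, fun hi' => absurd hi' hi⟩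
  choose N b s hwalk using hwalk
  -- The construction starts from the rounded net points as singletons, which puts them into `H`; a
  -- singleton is traversed by the constant walk.
  let 𝒜 : Finset (Set (Fin d → ℤ)) := 𝒩.image fun p => {gridRound h p}
  have h𝒜 : ⋃₀ (𝒜 : Set (Set (Fin d → ℤ))) = gridRound h '' (𝒩 : Set _) := by
    ext v
    simp [𝒜, eq_comm]
  obtain ⟨D', 𝒜', -, hsub, -, hsc, -, hr, hnew⟩ := HC gridAdj_symm hDh (e := e) (E := η) he0 N b s
    (fun i hi => (hwalk i hi).1) _ 𝒜 Finset.card_image_le he.le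
    (shortcut_add_const hDh _ he0 hη.le) (by
      intro A hA x hx y hy
      obtain ⟨p, hp, rfl⟩ := Finset.mem_image.1 hA
      rw [mem_singleton_iff] at hx hy
      subst hx hy
      exact .refl _ _ (mem_sUnion.2 ⟨_, hA, rfl⟩) (by
        have := hDh.nonneg (gridRound h p) (gridRound h p)
        positivity))
  rw [he] at hsc hr hnew
  have hcost : ∀ p ∈ 𝒩, ∀ q ∈ 𝒩,
      D (gridPt h (gridRound h p)) (gridPt h (gridRound h q)) + η ≤ D p q + 3 * η := by
    intro p hp q hq
    have h1 := hD.triangle (gridPt h (gridRound h p)) p (gridPt h (gridRound h q))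
    have h2 := hD.triangle p q (gridPt h (gridRound h q))
    rw [hD.comm _ p] at h1
    linarith [hround p hp, hround q hq]
  refine ⟨D', ⋃₀ (𝒜' : Set (Set (Fin d → ℤ))), hsc.isPMetric, hsc.lower, fun p hp => ?_,
    fun p hp q hq hpq => ?_, hround, fun v hv => ?_⟩
  · refine sUnion_subset_sUnion (Finset.coe_subset.2 hsub) ?_
    rw [h𝒜]
    exact ⟨p, hp, rfl⟩
  · obtain ⟨i, hi, hip⟩ := hpr' (p, q) (Finset.mem_filter.2 ⟨Finset.mem_product.2 ⟨hp, hq⟩, hpq⟩)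
    have h1 := hr i hi
    rw [(hwalk i hi).2.1, (hwalk i hi).2.2, hip] at h1
    exact h1.mono_cost (hcost p hp q hq)
  · rcases hnew v hv with h1 | ⟨i, hi, h1⟩
    · exact Or.inl (h𝒜 ▸ h1)
    · obtain ⟨hmem, hle'⟩ := Finset.mem_filter.1 (hpr i hi)
      obtain ⟨hp, hq⟩ := Finset.mem_product.1 hmem
      rw [(hwalk i hi).2.1, (hwalk i hi).2.2] at h1
      exact Or.inr ⟨(pr i).1, hp, h1.mono_cost
        ((hcost _ hp _ hq).trans (by linarith))⟩

/-- The intermediate value theorem on an almost shortest path gives the point; the partition `0 ≤ t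
≤ 1` bounds its distance to `y`. -/
theorem exists_point_at_distance (hD : IsPMetric D)
    (hc : Continuous fun p : EuclideanSpace ℝ (Fin d) × EuclideanSpace ℝ (Fin d) => D p.1 p.2)
    {x y : EuclideanSpace ℝ (Fin d)} {δ σ : ℝ} (hσ : 0 ≤ σ) (hxy : σ ≤ D x y)
    (hpath : ∃ γ : ℝ → EuclideanSpace ℝ (Fin d), Continuous γ ∧ γ 0 = x ∧
      γ 1 = y ∧ ∀ (n : ℕ) (u : ℕ → ℝ), Monotone u →
        ∑ i ∈ Finset.range n, D (γ (u i)) (γ (u (i + 1))) ≤ D x y + δ) :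
    ∃ z, D x z = σ ∧ D z y ≤ D x y - σ + δ := by
  obtain ⟨γ, hγ, h0, h1, hlen⟩ := hpath
  have hcont : Continuous fun t => D x (γ t) := hc.comp (continuous_const.prodMk hγ)
  obtain ⟨t, ht, hxt⟩ := intermediate_value_Icc zero_le_one hcont.continuousOn
    (show σ ∈ Icc (D x (γ 0)) (D x (γ 1)) by rw [h0, h1, hD.self]; exact ⟨hσ, hxy⟩)
  refine ⟨γ t, hxt, ?_⟩
  have h2 := hlen 2 (fun i => if i = 0 then 0 else if i = 1 then t else 1) (by
    refine monotone_nat_of_le_succ fun n => ?_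
    rcases n with _ | _ | n <;> simp [ht.1, ht.2])
  simp only [Finset.sum_range_succ, Finset.sum_range_zero, zero_add, if_true, one_ne_zero,
    if_false, h0] at h2
  norm_num [h1] at h2
  simp only at hxt
  linarith

/-- The constants are chosen in the order `ε'`, `σ`, `k₀`, `η`, net, `h`. A chain in the net has at
most about `k₀` links with an error of order `η` each, so `η` is taken of order `σ / k₀`; all other
errors are small multiples of `σ`. -/
theorem exists_conformal_approximation (hD : IsPMetric D)
    (hc : Continuous fun p : EuclideanSpace ℝ (Fin d) × EuclideanSpace ℝ (Fin d) => D p.1 p.2)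
    (hball : ∀ x r, IsCompact {y | D x y ≤ r})
    (hpath : ∀ x y, ∀ δ > 0, ∃ γ : ℝ → EuclideanSpace ℝ (Fin d), Continuous γ ∧ γ 0 = x ∧
      γ 1 = y ∧ ∀ (n : ℕ) (u : ℕ → ℝ), Monotone u →
        ∑ i ∈ Finset.range n, D (γ (u i)) (γ (u (i + 1))) ≤ D x y + δ)
    {ε R : ℝ} (hε : 0 < ε) (hR : 0 < R) :
    ∃ f : EuclideanSpace ℝ (Fin d) →ᵇ ℝ, ∀ x y : EuclideanSpace ℝ (Fin d),
      (∀ i, |x i| ≤ R) → (∀ i, |y i| ≤ R) → |D x y - conformalDist f x y| ≤ ε := by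
  obtain ⟨B, hB0, hB⟩ := exists_deriv_smoothTransition_le
  let ε' := ε / (5 + 4 * d ^ 2 * B)
  have hε' : 0 < ε' := by positivity
  let cube : ℝ → Set (EuclideanSpace ℝ (Fin d)) := fun S => {x | ∀ i, |x i| ≤ S}
  have hcube : ∀ S, IsCompact (cube S) := by
    intro S
    refine Metric.isCompact_of_isClosed_isBounded ?_ ?_
    · simp only [cube, Set.ofPred_forall]
      exact isClosed_iInter fun i => isClosed_le (by fun_prop) continuous_const
    · exact (Metric.isBounded_closedBall (x := 0) (r := d * S)).subset fun x hx => by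
        rw [mem_closedBall_zero_iff]
        exact norm_le_of_abs_le hx
  -- a bound for the distances in the cube
  obtain ⟨L, hL⟩ : ∃ L, ∀ x ∈ cube (R + 1), D 0 x ≤ L := by
    have h1 : Continuous fun x => D 0 x := hc.comp (continuous_const.prodMk continuous_id)
    obtain ⟨L, hL⟩ := ((hcube (R + 1)).image h1).bddAbove
    exact ⟨L, fun x hx => hL ⟨x, hx, rfl⟩⟩
  let σ := min (ε' / 20) (1 / 20)
  have hσ : 0 < σ := by positivity
  have hσε : 20 * σ ≤ ε' := by linarith [min_le_left (ε' / 20) (1 / 20)]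
  have hσ1 : 20 * σ ≤ 1 := by linarith [min_le_right (ε' / 20) (1 / 20)]
  -- The net points used below have `D`-distance at most `L + 1` from `0`, hence at most `2 * L + 2`
  -- from each other, and each link of a chain gains at least `σ / 2`.
  obtain ⟨k₀, hk₀⟩ := exists_nat_ge ((2 * L + 2) / (σ / 2))
  rw [div_le_iff₀ (by positivity)] at hk₀
  let η := σ / (6 * (k₀ + 1))
  have hη : 0 < η := by positivity
  have hηk : 6 * η * (k₀ + 1) = σ := by
    simp only [η]
    field_simp
  have hησ : 6 * η ≤ σ := by
    have : 0 ≤ η * k₀ := by positivity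
    linarith
  -- the net
  obtain ⟨τ, hτ, hmod⟩ := exists_modulus hD hc (hcube (R + 2)) hσ
  let r₁ := min τ 1 / (2 * (d + 1))
  have hr₁ : 0 < r₁ := by positivity
  have hr₁' : d * (2 * r₁) ≤ min τ 1 := by
    have h1 : 2 * (d + 1) * r₁ = min τ 1 := by
      simp only [r₁]
      field_simp
    linarith
  -- The net covers a `D`-ball that contains the intermediate points of all chains, which may leave
  -- the cube; this ball is compact by bounded compactness. Closeness is required for `D` and for
  -- the coordinates: the first serves the chains, the second the retraction.
  obtain ⟨𝒩, h𝒩⟩ : ∃ 𝒩 : Finset (EuclideanSpace ℝ (Fin d)),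
      ∀ z, D 0 z ≤ (L + 1) + k₀ * (σ / 2) → ∃ p ∈ 𝒩, D z p ≤ η ∧ ∀ i, |z i - p i| ≤ r₁ := by
    obtain ⟨t, -, ht⟩ := (hball 0 (L + 1 + k₀ * (σ / 2))).elim_nhds_subcover
      (fun p => {z | D z p < η} ∩ Metric.ball p r₁) fun p _ => by
        have h1 : Continuous fun z => D z p := hc.comp (continuous_id.prodMk continuous_const)
        exact ((isOpen_lt h1 continuous_const).inter Metric.isOpen_ball).mem_nhds
          ⟨by simpa [hD.self] using hη, Metric.mem_ball_self hr₁⟩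
    refine ⟨t, fun z hz => ?_⟩
    obtain ⟨p, hp, hzp⟩ := mem_iUnion₂.1 (ht hz)
    refine ⟨p, hp, (show D z p < η from hzp.1).le, fun i => ?_⟩
    have h2 := hzp.2
    rw [Metric.mem_ball, dist_eq_norm] at h2
    exact (PiLp.norm_apply_le (z - p) i).trans h2.le
  obtain ⟨h₀, hh₀, hgrid⟩ := exists_grid_shortcut hD hc hpath 𝒩 (ε₁ := σ + 2 * η) hη
  let h := min h₀ (min (1 / 4) (min (r₁ / 4) (τ / 4)))
  have hh : 0 < h := by positivity
  have hhle : h ≤ h₀ := min_le_left _ _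
  have hh4 : h ≤ 1 / 4 := (min_le_right _ _).trans (min_le_left _ _)
  have hhr : h ≤ r₁ / 4 := ((min_le_right _ _).trans (min_le_right _ _)).trans (min_le_left _ _)
  have hhτ : h ≤ τ / 4 := ((min_le_right _ _).trans (min_le_right _ _)).trans (min_le_right _ _)
  obtain ⟨D₁, H, hD₁, hlow, hmem, hshort, hround, hnew⟩ := hgrid h hh hhle
  have hL0 : 0 ≤ L := by
    have h1 := hL 0 (fun i => by simp; linarith)
    rwa [hD.self] at h1
  have hHne : H.Nonempty := by
    obtain ⟨p, hp, -⟩ := h𝒩 0 (by rw [hD.self]; positivity)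
    exact ⟨_, hmem p hp⟩
  obtain ⟨r, hrH, hrid, hrdist, hrreach⟩ := exists_grid_retraction hHne
  -- The pseudometric on the grid is `D₁` pulled back by the retraction onto `H`.
  have hD' := hD₁.comp r
  -- the retraction moves the grid points of the cube a little only
  have hmove : ∀ v : Fin d → ℤ, (∀ i, |h * v i| ≤ R + 1) →
      D (gridPt h v) (gridPt h (r v)) ≤ σ := by
    intro v hv
    obtain ⟨p, hp, -, hvp⟩ := h𝒩 (gridPt h v) (by
      have := hL (gridPt h v) hv
      have : 0 ≤ k₀ * (σ / 2) := by positivity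
      linarith)
    have h1 : (gridDist v (gridRound h p) : ℝ) ≤ d * (2 * r₁ / h) := by
      refine gridDist_le fun i => ?_
      rw [le_div_iff₀ hh, mul_comm, ← abs_of_pos hh, ← abs_mul, abs_of_pos hh, mul_sub]
      have h2 := abs_le.1 (hvp i)
      have h3 := abs_le.1 (abs_sub_gridRound_le hh p i)
      rw [gridPt_apply] at h2
      rw [abs_le]
      constructor <;> linarith
    have h2 : (gridDist v (r v) : ℝ) ≤ d * (2 * r₁ / h) :=
      le_trans (by exact_mod_cast hrdist v _ (hmem p hp)) h1
    have h3 : ∀ i, |gridPt h v i - gridPt h (r v) i| ≤ min τ 1 := by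
      intro i
      rw [gridPt_apply, gridPt_apply, ← mul_sub, abs_mul, abs_of_pos hh]
      calc h * |(v i : ℝ) - r v i| ≤ h * (d * (2 * r₁ / h)) := by
            gcongr
            exact (abs_sub_le_gridDist _ _ i).trans h2
        _ = d * (2 * r₁) := by field_simp
        _ ≤ min τ 1 := hr₁'
    exact hmod _ (fun i => (hv i).trans (by linarith)) _ fun i => (h3 i).trans (min_le_left _ _)
  -- every vertex of the graph is close to the net
  have htonet : ∀ v ∈ H, ∃ p ∈ 𝒩, Reach gridAdj D₁ H (gridRound h p) v (2 * σ) := by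
    intro v hv
    rcases hnew v hv with ⟨p, hp, rfl⟩ | ⟨p, hp, hreach⟩
    · exact ⟨p, hp, .refl _ _ hv (by positivity)⟩
    · exact ⟨p, hp, hreach.mono_cost (by linarith)⟩
  -- The retraction fixes `H`, so walks in `H` keep their cost.
  have hin : ∀ {x y : Fin d → ℤ} {c : ℝ}, Reach gridAdj D₁ H x y c →
      Reach gridAdj (fun x y => D₁ (r x) (r y)) univ x y c := fun hxy =>
    hxy.mono (subset_univ _) fun x hx y hy => by rw [hrid x hx, hrid y hy]
  have hfind : ∀ v : Fin d → ℤ, (∀ i, |h * v i| ≤ R + 1) → ∃ p ∈ 𝒩,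
      D (gridPt h v) p ≤ 4 * σ ∧
        Reach gridAdj (fun x y => D₁ (r x) (r y)) univ v (gridRound h p) (2 * σ) := by
    intro v hv
    obtain ⟨p, hp, hpv⟩ := htonet (r v) (hrH v)
    refine ⟨p, hp, ?_, ?_⟩
    · have h1 := hpv.dist_le hD₁
      have h2 := hlow (gridRound h p) (r v)
      have h3 := hD.triangle (gridPt h v) (gridPt h (r v)) p
      have h4 := hD.triangle p (gridPt h (gridRound h p)) (gridPt h (r v))
      rw [hD.comm (gridPt h (r v)) p] at h3
      linarith [hmove v hv, hround p hp]
    · exact ((hrreach D₁ hD₁ v).trans ((hin hpv).symm gridAdj_symm hD')).mono_cost (by simp)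
  obtain ⟨f, hf⟩ := exists_conformal_of_grid (D := D) (R := R) (ε := ε') hh hh4 hD hD' hε' hB0 hB
    (fun v w hv hw => by
      have h1 := hlow (r v) (r w)
      have h2 := hD.triangle (gridPt h v) (gridPt h (r v)) (gridPt h w)
      have h3 := hD.triangle (gridPt h (r v)) (gridPt h (r w)) (gridPt h w)
      rw [hD.comm (gridPt h (r w)) (gridPt h w)] at h3
      linarith [hmove v hv, hmove w hw])
    -- The walk runs from `v` to a net point `p`, through the net to `q`, and on to `w`. The ends
    -- cost `2 * σ` each, the chain exceeds `D p q` by `σ`, and `D p q` exceeds the distance of the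
    -- grid points by at most `8 * σ`.
    (fun v w hv hw => by
      obtain ⟨p, hp, hvp, hrp⟩ := hfind v hv
      obtain ⟨q, hq, hwq, hrq⟩ := hfind w hw
      have h2 := hD.triangle p (gridPt h v) q
      have h3 := hD.triangle (gridPt h v) (gridPt h w) q
      have h4 := hD.triangle (gridPt h v) 0 (gridPt h w)
      have h5 := hD.triangle 0 (gridPt h w) q
      rw [hD.comm p (gridPt h v)] at h2
      rw [hD.comm _ 0] at h4
      have h6 := hL (gridPt h v) hv
      have h7 := hL (gridPt h w) hw
      have h1 := reach_of_reach_nearby (𝒩 := (𝒩 : Set (EuclideanSpace ℝ (Fin d)))) (x₀ := 0)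
        (Λ := L + 1) (k₀ := k₀) (σ := σ) hD hη.le (by linarith)
        (fun x y hxy => exists_point_at_distance hD hc hσ.le hxy (hpath x y η hη))
        (fun z hz => (h𝒩 z hz).imp fun p hp => ⟨hp.1, hp.2.1⟩) hshort k₀ le_rfl p q p q
        (by linarith) (by linarith) hp hq (by rw [hD.self]; exact hη.le)
        (by rw [hD.self]; exact hη.le)
      exact ((hrp.trans (hin h1)).trans (hrq.symm gridAdj_symm hD')).mono_cost (by linarith))
    (fun x y hx _ hxy => by
      have := hmod x (fun i => (hx i).trans (by linarith)) y fun i =>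
        (hxy i).trans (by linarith)
      linarith)
  refine ⟨f, fun x y hx hy => (hf x y hx hy).trans (le_of_eq ?_)⟩
  simp only [ε']
  field_simp

end Assembly

/-! ### The theorem -/

theorem theorem1 (d : ℕ)
    (D : EuclideanSpace ℝ (Fin d) → EuclideanSpace ℝ (Fin d) → ℝ) (hD : IsMetric D)
    (hcompact : hD.BoundedlyCompact) (hlength : hD.IsLengthMetric)
    (htop : hD.InducesTopology) (ε R : ℝ) (hε : 0 < ε) (hR : 0 < R) :
    ∃ f : EuclideanSpace ℝ (Fin d) →ᵇ ℝ,
      ∀ x y : EuclideanSpace ℝ (Fin d),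
        (∀ i, x i ∈ Icc (-R) R) → (∀ i, y i ∈ Icc (-R) R) →
          |D x y - conformalDist f x y| ≤ ε := by
  obtain ⟨f, hf⟩ := exists_conformal_approximation hD.isPMetric
    (hD.continuous_of_inducesTopology htop) (hD.isCompact_closedBall htop hcompact)
    (fun x y δ hδ => hD.exists_almost_shortest_path htop hlength x y hδ) hε hR
  exact ⟨f, fun x y hx hy => hf x y (fun i => abs_le.2 (hx i)) fun i => abs_le.2 (hy i)⟩
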